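/- Let $k$ be a field, let $G$ be an abelian group (written additively), let $A=\bigoplus_{\sigma\in G}A_\sigma$ be a $G$-graded $k$-algebra (associative, unital, with $A_\sigma A_\tau\subseteq A_{\sigma+\tau}$), and let $d\ge 0$ be an integer. Let $A^e=A\otimes_k A^{\mathrm{op}}$, graded by letting $(A^e)_\gamma$ be the span of all $a\otimes b^{\mathrm{op}}$ with $a\in A_\sigma$, $b\in A_\tau$, $\sigma+\tau=\gamma$. All $(A,A)$-bimodules are $k$-central and are identified with left $A^e$-modules through $(a\otimes b^{\mathrm{op}})\cdot m=amb$; a right $A^e$-module is regarded as an $(A,A)$-bimodule through $amb=m\cdot(b\otimes a^{\mathrm{op}})$. Graded $(A,A)$-bimodules are $G$-graded left $A^e$-modules, and morphisms of graded modules preserve degrees. *Ungraded notions.* $A$ is homologically smooth if it has a finite-length resolution by finitely generated projective left $A^e$-modules. A bimodule $U$ is invertible if there is a bimodule $V$ with $U\otimes_A V\cong V\otimes_A U\cong A$ as bimodules. $A$ is twisted Calabi–Yau of dimension $d$ if $A$ is homologically smooth and there is an invertible bimodule $U$ such that $\mathrm{Ext}^i_{A^e}(A,A^e)=0$ for all $i\ne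 d$ and $\mathrm{Ext}^d_{A^e}(A,A^e)\cong U$ as bimodules, where the Ext groups are right $A^e$-modules through right multiplication on the second argument $A^e$. *Graded notions.* For a graded left $A^e$-module $M$ let $\underline{\mathrm{Hom}}_{A^e}(M,A^e)=\bigoplus_{\tau\in G}\{f\in\mathrm{Hom}_{A^e}(M,A^e): f(M_\sigma)\subseteq (A^e)_{\sigma+\tau}\text{ for all }\sigma\}$, and let $\underline{\mathrm{Ext}}^i_{A^e}(M,A^e)$ be its derived functors, i.e. the $i$-th cohomology of $\underline{\mathrm{Hom}}_{A^e}(P_\bullet,A^e)$ for a projective resolution $P_\bullet$ of $M$ in the category of graded left $A^e$-modules, with its induced grading and right $A^e$-module structure. $A$ is $G$-graded homologically smooth if it has a finite-length resolution by finitely generated projective objects in the category of graded left $A^e$-modules. A graded bimodule $U$ is $G$-graded invertible if there is a graded bimodule $V$ with $U\otimes_A V\cong V\otimes_A U\cong A$ as graded bimodules, where $(U\otimes_A V)_\gamma$ is spanned by the $u\otimes v$ with $u\in U_\sigma$, $v\in V_\tau$, $\sigma+\tau=\gamma$. $A$ is $G$-graded twisted Calabi–Yau of dimension $d$ if $A$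 is $G$-graded homologically smooth and there is a $G$-graded invertible bimodule $U$ such that $\underline{\mathrm{Ext}}^i_{A^e}(A,A^e)=0$ for all $i\neq d$ and $\underline{\mathrm{Ext}}^d_{A^e}(A,A^e)\cong U$ as graded bimodules. **Theorem.** $A$ is twisted Calabi–Yau of dimension $d$ if and only if $A$ is $G$-graded twisted Calabi–Yau of dimension $d$. -/

import Mathlib

open scoped TensorProduct DirectSum

universe u v w

noncomputable section

namespace GradedCY

section Subquotient

variable {S W : Type*} [Ring S] [AddCommGroup W] [Module S W]

/-- The subquotient `Z / (B ∩ Z)` of a module. -/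
def Subquotient (Z B : Submodule S W) : Type _ := Z ⧸ B.submoduleOf Z

instance (Z B : Submodule S W) : AddCommGroup (Subquotient Z B) :=
  inferInstanceAs (AddCommGroup (Z ⧸ B.submoduleOf Z))

instance (Z B : Submodule S W) : Module S (Subquotient Z B) :=
  inferInstanceAs (Module S (Z ⧸ B.submoduleOf Z))

/-- The class of an element of `Z`. -/
def Subquotient.mk (Z B : Submodule S W) : Z →ₗ[S] Subquotient Z B := (B.submoduleOf Z).mkQ

end Subquotient

/-! ### Graded left modules over a graded algebra -/

section GradedModules

variable {k : Type u} [Field k] {G : Type w} [AddCommGroup G] [DecidableEq G]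
variable {R : Type v} [Ring R] [Algebra k R]

/-- A family of subgroups that spans, and that admits projections killing the other members,
is a direct sum decomposition. -/
theorem isInternal_of_proj {M : Type v} [AddCommGroup M] (deg : G → AddSubgroup M)
    (htop : ⨆ i, deg i = ⊤) (π : G → M →+ M) (hπ : ∀ i, ∀ x ∈ deg i, π i x = x)
    (hπ' : ∀ i j, j ≠ i → ∀ x ∈ deg j, π i x = 0) : DirectSum.IsInternal deg := by
  have key : ∀ (i : G) (f : ⨁ i, deg i),
      π i (DirectSum.coeAddMonoidHom deg f) = ((f i : deg i) : M) := by
    intro i f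
    induction f using DirectSum.induction_on with
    | zero => simp
    | of j x =>
      rw [DirectSum.coeAddMonoidHom_of]
      by_cases h : j = i
      · subst h
        rw [hπ _ _ x.2, DirectSum.of_eq_same]
      · rw [hπ' i j h _ x.2, DirectSum.of_eq_of_ne _ _ _ (Ne.symm h)]
        rfl
    | add f g hf hg => simp [hf, hg]
  constructor
  · rw [injective_iff_map_eq_zero]
    intro f hf
    ext i
    rw [← key i f, hf]
    simp
  · intro x
    have hx : x ∈ ⨆ i, deg i := htop ▸ AddSubgroup.mem_top x
    induction hx using AddSubgroup.iSup_induction' with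
    | hp i x hx => exact ⟨DirectSum.of _ i ⟨x, hx⟩, by simp⟩
    | h1 => exact ⟨0, by simp⟩
    | hadd x y _ _ h1 h2 =>
      obtain ⟨a, rfl⟩ := h1
      obtain ⟨b, rfl⟩ := h2
      exact ⟨a + b, by simp⟩

/-- A `G`-graded left module over the graded algebra `(R, 𝓡)`. -/
structure GrMod (𝓡 : G → Submodule k R) where
  carrier : Type v
  [addCommGroup : AddCommGroup carrier]
  [module : Module R carrier]
  deg : G → AddSubgroup carrier
  isInternal : DirectSum.IsInternal deg
  smul_mem : ∀ {i j : G} {r : R} {m : carrier}, r ∈ 𝓡 i → m ∈ deg j → r • m ∈ deg (i + j)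

attribute [instance] GrMod.addCommGroup GrMod.module

variable {𝓡 : G → Submodule k R}

/-- A homomorphism of graded modules (of degree zero). -/
def IsGrHom (M N : GrMod 𝓡) (f : M.carrier →ₗ[R] N.carrier) : Prop :=
  ∀ i, ∀ m ∈ M.deg i, f m ∈ N.deg i

/-- Projective objects of the category of graded modules. -/
def IsGrProjective (P : GrMod 𝓡) : Prop :=
  ∀ (X Y : GrMod 𝓡) (q : X.carrier →ₗ[R] Y.carrier) (g : P.carrier →ₗ[R] Y.carrier),
    IsGrHom X Y q → Function.Surjective q → IsGrHom P Y g →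
      ∃ h : P.carrier →ₗ[R] X.carrier, IsGrHom P X h ∧ q ∘ₗ h = g

/-- Projective resolutions in the category of graded modules. -/
structure GrProjRes (M : GrMod 𝓡) where
  X : ℕ → GrMod 𝓡
  d : ∀ n, (X (n + 1)).carrier →ₗ[R] (X n).carrier
  ε : (X 0).carrier →ₗ[R] M.carrier
  d_graded : ∀ n, IsGrHom (X (n + 1)) (X n) (d n)
  ε_graded : IsGrHom (X 0) M ε
  projective : ∀ n, IsGrProjective (X n)
  ε_surjective : Function.Surjective ε
  exact_zero : Function.Exact (d 0) ε
  exact_succ : ∀ n, Function.Exact (d (n + 1)) (d n)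

/-- The projection of a graded module onto its component of degree `i`. -/
def GrMod.proj (M : GrMod 𝓡) (i : G) : M.carrier →+ M.carrier :=
  letI := M.isInternal.chooseDecomposition
  (M.deg i).subtype.comp
    ((DFinsupp.evalAddMonoidHom i).comp (DirectSum.decomposeAddEquiv M.deg).toAddMonoidHom)

theorem GrMod.proj_mem (M : GrMod 𝓡) (i : G) (x : M.carrier) : M.proj i x ∈ M.deg i :=
  SetLike.coe_mem _

theorem GrMod.proj_same (M : GrMod 𝓡) (i : G) (x : M.carrier) (hx : x ∈ M.deg i) :
    M.proj i x = x :=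
  letI := M.isInternal.chooseDecomposition
  DirectSum.decompose_of_mem_same M.deg hx

theorem GrMod.proj_ne (M : GrMod 𝓡) (i j : G) (h : j ≠ i) (x : M.carrier) (hx : x ∈ M.deg j) :
    M.proj i x = 0 :=
  letI := M.isInternal.chooseDecomposition
  DirectSum.decompose_of_mem_ne M.deg hx h

theorem GrMod.iSup_deg (M : GrMod 𝓡) : ⨆ i, M.deg i = ⊤ := by
  rw [eq_top_iff]
  intro x _
  obtain ⟨f, rfl⟩ := M.isInternal.2 x
  induction f using DirectSum.induction_on with
  | zero => simp
  | of j x =>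
    rw [DirectSum.coeAddMonoidHom_of]
    exact AddSubgroup.mem_iSup_of_mem j x.2
  | add f g hf hg =>
    rw [map_add]
    exact add_mem (hf trivial) (hg trivial)

theorem GrMod.exists_sum_proj (M : GrMod 𝓡) (x : M.carrier) :
    ∃ s : Finset G, x = ∑ i ∈ s, M.proj i x := by
  classical
  let _ := M.isInternal.chooseDecomposition
  exact ⟨_, (DirectSum.sum_support_decompose M.deg x).symm⟩

/-- Graded homomorphisms commute with the projections. -/
theorem IsGrHom.map_proj {M N : GrMod 𝓡} {f : M.carrier →ₗ[R] N.carrier} (hf : IsGrHom M N f)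
    (i : G) (x : M.carrier) : f (M.proj i x) = N.proj i (f x) := by
  have hx : x ∈ ⨆ i, M.deg i := M.iSup_deg ▸ AddSubgroup.mem_top x
  induction hx using AddSubgroup.iSup_induction' with
  | hp j x hx =>
    by_cases h : j = i
    · subst h
      rw [M.proj_same _ _ hx, N.proj_same _ _ (hf _ _ hx)]
    · rw [M.proj_ne _ _ h _ hx, N.proj_ne _ _ h _ (hf _ _ hx), map_zero]
  | h1 => simp
  | hadd x y _ _ h1 h2 => simp [h1, h2]

/-- The kernel of a homomorphism of graded modules. -/
abbrev GrMod.ker {M N : GrMod 𝓡} (f : M.carrier →ₗ[R] N.carrier) (hf : IsGrHom M N f) :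
    GrMod 𝓡 where
  carrier := LinearMap.ker f
  deg i := (M.deg i).comap (LinearMap.ker f).subtype.toAddMonoidHom
  isInternal := by
    have hker : ∀ i (x : LinearMap.ker f), M.proj i x.1 ∈ LinearMap.ker f := fun i x => by
      rw [LinearMap.mem_ker, hf.map_proj, LinearMap.mem_ker.1 x.2, map_zero]
    refine isInternal_of_proj _ ?_
      (fun i => AddMonoidHom.mk' (fun x => ⟨M.proj i x.1, hker i x⟩)
        (fun x y => Subtype.ext (by simp))) ?_ ?_
    · rw [eq_top_iff]
      intro x _
      obtain ⟨s, hs⟩ := M.exists_sum_proj x.1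
      have : x = ∑ i ∈ s, (⟨M.proj i x.1, hker i x⟩ : LinearMap.ker f) :=
        Subtype.ext (by simpa using hs)
      rw [this]
      exact sum_mem fun i _ => AddSubgroup.mem_iSup_of_mem i (M.proj_mem i x.1)
    · exact fun i x hx => Subtype.ext (M.proj_same i x.1 hx)
    · exact fun i j h x hx => Subtype.ext (M.proj_ne i j h x.1 hx)
  smul_mem hr hm := M.smul_mem hr hm

section Free

variable [GradedAlgebra 𝓡]

/-- The graded free module on homogeneous generators `x : ι` of degrees `e x`. -/
abbrev GrMod.free (𝓡 : G → Submodule k R) [GradedAlgebra 𝓡] (ι : Type v) (e : ι → G) :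
    GrMod 𝓡 where
  carrier := Π₀ _ : ι, R
  deg γ :=
    { carrier := {f | ∀ x, f x ∈ 𝓡 (γ - e x)}
      zero_mem' := fun x => by simp
      add_mem' := fun hf hg x => by simpa using add_mem (hf x) (hg x)
      neg_mem' := fun hf x => by simpa using hf x }
  isInternal := by
    classical
    refine isInternal_of_proj _ ?_
      (fun γ => DFinsupp.mapRange.addMonoidHom fun x => GradedRing.proj 𝓡 (γ - e x)) ?_ ?_
    · rw [eq_top_iff]
      intro f _
      induction f using DFinsupp.induction with
      | h0 => exact zero_mem _
      | ha x r f _ _ ih =>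
        refine add_mem ?_ (ih trivial)
        rw [← DirectSum.sum_support_decompose 𝓡 r, ← DFinsupp.singleAddHom_apply, map_sum]
        refine sum_mem fun i _ => AddSubgroup.mem_iSup_of_mem (i + e x) fun y => ?_
        by_cases h : x = y
        · subst h
          simp
        · simp [DFinsupp.single_eq_of_ne (Ne.symm h)]
    · intro i f hf
      ext x
      simpa using DirectSum.decompose_of_mem_same 𝓡 (hf x)
    · intro i j h f hf
      ext x
      simpa using DirectSum.decompose_of_mem_ne 𝓡 (hf x) (fun h' => h (by simpa using h'))
  smul_mem := by
    intro i j r f hr hf x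
    have := SetLike.GradedMul.mul_mem hr (hf x)
    rw [← add_sub_assoc] at this
    simpa using this

theorem GrMod.free_isGrProjective (ι : Type v) (e : ι → G) :
    IsGrProjective (GrMod.free 𝓡 ι e) := by
  classical
  intro X Y q g hq hs hg
  have hgen : ∀ x : ι, ∃ c ∈ X.deg (e x), q c = g (DFinsupp.single x (1 : R)) := by
    intro x
    have h1 : g (DFinsupp.single x (1 : R)) ∈ Y.deg (e x) := by
      refine hg (e x) _ fun y => ?_
      by_cases h : x = y
      · subst h
        simpa using SetLike.GradedOne.one_mem (A := 𝓡)
      · simp [DFinsupp.single_eq_of_ne (Ne.symm h)]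
    obtain ⟨c, hc⟩ := hs (g (DFinsupp.single x (1 : R)))
    refine ⟨X.proj (e x) c, X.proj_mem _ _, ?_⟩
    rw [hq.map_proj, hc, Y.proj_same _ _ h1]
  choose c hc hqc using hgen
  refine ⟨DFinsupp.lsum ℕ fun x => LinearMap.toSpanSingleton R X.carrier (c x), ?_, ?_⟩
  · intro γ f hf
    have : (DFinsupp.lsum ℕ fun x => LinearMap.toSpanSingleton R X.carrier (c x)) f
        = f.sum fun x r => r • c x := by
      simp [DFinsupp.sumAddHom_apply]
      rfl
    rw [this]
    refine sum_mem fun x _ => ?_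
    have := X.smul_mem (hf x) (hc x)
    rwa [sub_add_cancel] at this
  · refine DFinsupp.lhom_ext' fun x => LinearMap.ext_ring ?_
    simp [hqc]

/-- Every graded module is a graded quotient of a graded free module. -/
theorem GrMod.exists_cover (M : GrMod 𝓡) :
    ∃ (F : GrMod 𝓡) (p : F.carrier →ₗ[R] M.carrier),
      IsGrProjective F ∧ IsGrHom F M p ∧ Function.Surjective p := by
  classical
  let ι : Type v := {m : M.carrier // ∃ i, m ∈ M.deg i}
  let e : ι → G := fun m => m.2.choose
  let p : (Π₀ _ : ι, R) →ₗ[R] M.carrier :=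
    DFinsupp.lsum ℕ fun m : ι => LinearMap.toSpanSingleton R M.carrier m.1
  refine ⟨GrMod.free 𝓡 ι e, p, GrMod.free_isGrProjective ι e, ?_, ?_⟩
  · intro γ f hf
    have : p f = f.sum fun x r => r • x.1 := by
      simp [p, DFinsupp.sumAddHom_apply]
      rfl
    rw [this]
    refine sum_mem fun x _ => ?_
    have := M.smul_mem (hf x) x.2.choose_spec
    rwa [sub_add_cancel] at this
  · intro x
    have hx : x ∈ ⨆ i, M.deg i := M.iSup_deg ▸ AddSubgroup.mem_top x
    induction hx using AddSubgroup.iSup_induction' with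
    | hp j x hx =>
      exact ⟨DFinsupp.single (⟨x, j, hx⟩ : ι) (1 : R), by simp [p]⟩
    | h1 => exact ⟨0, map_zero _⟩
    | hadd x y _ _ h1 h2 =>
      obtain ⟨a, rfl⟩ := h1
      obtain ⟨b, rfl⟩ := h2
      exact ⟨a + b, map_add _ _ _⟩

end Free

section Resolutions

variable [GradedAlgebra 𝓡]

/-- A chosen graded projective cover of `M`. -/
def GrMod.cov (M : GrMod 𝓡) : GrMod 𝓡 := M.exists_cover.choose

/-- The projection of the chosen cover. -/
def GrMod.covMap (M : GrMod 𝓡) : M.cov.carrier →ₗ[R] M.carrier := M.exists_cover.choose_spec.choose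

theorem GrMod.covMap_spec (M : GrMod 𝓡) :
    IsGrProjective M.cov ∧ IsGrHom M.cov M M.covMap ∧ Function.Surjective M.covMap :=
  M.exists_cover.choose_spec.choose_spec

/-- The iterated syzygies of `M`. -/
def GrMod.syz (M : GrMod 𝓡) : ℕ → GrMod 𝓡
  | 0 => M
  | n + 1 => GrMod.ker (M.syz n).covMap (M.syz n).covMap_spec.2.1

/-- The inclusion of a syzygy into the preceding cover. -/
def GrMod.syzIncl (M : GrMod 𝓡) (n : ℕ) : (M.syz (n + 1)).carrier →ₗ[R] (M.syz n).cov.carrier :=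
  (LinearMap.ker (M.syz n).covMap).subtype

theorem GrMod.exact_syz (M : GrMod 𝓡) (n : ℕ) :
    Function.Exact (M.syzIncl n ∘ₗ (M.syz (n + 1)).covMap) (M.syz n).covMap := by
  intro y
  constructor
  · intro hy
    obtain ⟨z, hz⟩ := (M.syz (n + 1)).covMap_spec.2.2 ⟨y, hy⟩
    exact ⟨z, congrArg Subtype.val hz⟩
  · rintro ⟨z, rfl⟩
    exact ((M.syz (n + 1)).covMap z).2

/-- Graded projective resolutions exist. -/
theorem GrProjRes.exists (M : GrMod 𝓡) : Nonempty (GrProjRes M) :=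
  ⟨{ X := fun n => (M.syz n).cov
     d := fun n => M.syzIncl n ∘ₗ (M.syz (n + 1)).covMap
     ε := M.covMap
     d_graded := fun n i m hm => (M.syz (n + 1)).covMap_spec.2.1 i m hm
     ε_graded := M.covMap_spec.2.1
     projective := fun n => (M.syz n).covMap_spec.1
     ε_surjective := M.covMap_spec.2.2
     exact_zero := M.exact_syz 0
     exact_succ := fun n y => by
       rw [← M.exact_syz (n + 1) y]
       exact ⟨fun h => Subtype.ext h, fun h => congrArg Subtype.val h⟩ }⟩

end Resolutions

/-! ### The total `HOM` into the algebra and its derived functors -/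

/-- Homomorphisms `f : M → R` of degree `τ`, that is, `f (M_σ) ⊆ R_(σ + τ)` for all `σ`. -/
def homDeg (M : GrMod 𝓡) (τ : G) : AddSubgroup (M.carrier →ₗ[R] R) where
  carrier := {f | ∀ σ, ∀ m ∈ M.deg σ, f m ∈ 𝓡 (σ + τ)}
  zero_mem' := fun σ m _ => by simp
  add_mem' := fun hf hg σ m hm => by simpa using add_mem (hf σ m hm) (hg σ m hm)
  neg_mem' := fun hf σ m hm => by simpa using hf σ m hm

variable [GradedAlgebra 𝓡]

/-- The total group `HOM_R(M, R)`, the sum of the `homDeg M τ` inside `Hom_R(M, R)`. It is a right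
`R`-module through `(f · r)(m) = f(m) r`. -/
def totalHom (M : GrMod 𝓡) : Submodule Rᵐᵒᵖ (M.carrier →ₗ[R] R) where
  toAddSubmonoid := (⨆ τ, homDeg M τ).toAddSubmonoid
  smul_mem' := by
    classical
    intro r f hf
    change f ∈ ⨆ τ, homDeg M τ at hf
    change r • f ∈ ⨆ τ, homDeg M τ
    induction hf using AddSubgroup.iSup_induction' with
    | hp τ f hf =>
      have hr : r • f = ∑ i ∈ (DirectSum.decompose 𝓡 r.unop).support,
          MulOpposite.op (DirectSum.decompose 𝓡 r.unop i : R) • f := by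
        rw [← Finset.sum_smul, ← Finset.op_sum, DirectSum.sum_support_decompose 𝓡 r.unop,
          MulOpposite.op_unop]
      rw [hr]
      refine sum_mem fun i _ => AddSubgroup.mem_iSup_of_mem (τ + i) fun σ m hm => ?_
      have := SetLike.GradedMul.mul_mem (hf σ m hm) (DirectSum.decompose 𝓡 r.unop i).2
      rw [add_assoc] at this
      simpa using this
    | h1 => simp
    | hadd f g _ _ h1 h2 =>
      rw [smul_add]
      exact add_mem h1 h2

/-- Precomposition with a homomorphism of left modules, as a map of right `R`-modules. -/
def precomp {X Y : Type v} [AddCommGroup X] [Module R X] [AddCommGroup Y] [Module R Y]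
    (d : X →ₗ[R] Y) : (Y →ₗ[R] R) →ₗ[Rᵐᵒᵖ] (X →ₗ[R] R) where
  toFun f := f ∘ₗ d
  map_add' _ _ := rfl
  map_smul' _ _ := rfl

namespace GrProjRes

variable {M : GrMod 𝓡} (P : GrProjRes M)

/-- Cocycles of the complex `HOM_R(P_•, R)`. -/
def cocycles (n : ℕ) : Submodule Rᵐᵒᵖ ((P.X n).carrier →ₗ[R] R) :=
  totalHom (P.X n) ⊓ LinearMap.ker (precomp (P.d n))

/-- Coboundaries of the complex `HOM_R(P_•, R)`. -/
def coboundaries : ∀ n : ℕ, Submodule Rᵐᵒᵖ ((P.X n).carrier →ₗ[R] R)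
  | 0 => ⊥
  | n + 1 => (totalHom (P.X n)).map (precomp (P.d n))

/-- The cohomology of the complex `HOM_R(P_•, R)`, a right `R`-module. -/
abbrev cohomology (n : ℕ) : Type v := Subquotient (P.cocycles n) (P.coboundaries n)

/-- The degree `τ` component of the cohomology: the classes of the cocycles of degree `τ`. -/
def cohomologyDeg (n : ℕ) (τ : G) : AddSubgroup (P.cohomology n) where
  carrier := {x | ∃ z : P.cocycles n, z.1 ∈ homDeg (P.X n) τ ∧
    Subquotient.mk (P.cocycles n) (P.coboundaries n) z = x}
  zero_mem' := ⟨0, zero_mem _, map_zero _⟩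
  add_mem' := by
    rintro _ _ ⟨y, hy, rfl⟩ ⟨z, hz, rfl⟩
    exact ⟨y + z, add_mem hy hz, map_add _ _ _⟩
  neg_mem' := by
    rintro _ ⟨y, hy, rfl⟩
    refine ⟨-y, neg_mem hy, eq_neg_of_add_eq_zero_left ?_⟩
    have h : -y + y = 0 := Subtype.ext (neg_add_cancel y.1)
    rw [← map_add, h, map_zero]

end GrProjRes

/-- The total graded `Ext^n_R(M, R)`, derived from `HOM_R(-, R)` through a chosen projective
resolution of `M` in the category of graded modules. It is a right `R`-module. -/
abbrev grExt (M : GrMod 𝓡) (n : ℕ) : Type v :=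
  (Classical.choice (GrProjRes.exists M)).cohomology n

/-- The grading of the total graded `Ext`. -/
def grExtDeg (M : GrMod 𝓡) (n : ℕ) (τ : G) : AddSubgroup (grExt M n) :=
  (Classical.choice (GrProjRes.exists M)).cohomologyDeg n τ

end GradedModules

/-! ### Ungraded `Ext^n_R(M, R)` as a right `R`-module -/

section Ext

open CategoryTheory

variable {R : Type v} [Ring R]

/-- Right multiplication by `r`, an endomorphism of the left module `R`. -/
def rightMul (r : R) : ModuleCat.of R R ⟶ ModuleCat.of R R :=
  ModuleCat.ofHom (LinearMap.toSpanSingleton R R r)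

/-- Mathlib's `Ext^n_R(M, R)` in the category of left `R`-modules. -/
abbrev ExtR (M : ModuleCat.{v} R) (n : ℕ) : Type v := Abelian.Ext M (ModuleCat.of R R) n

/-- The right `R`-module structure of `Ext^n_R(M, R)`, induced by right multiplications on the
second argument. -/
instance (M : ModuleCat.{v} R) (n : ℕ) : Module Rᵐᵒᵖ (ExtR M n) where
  smul r x := Abelian.Ext.comp (x : Abelian.Ext M (ModuleCat.of R R) n)
    (Abelian.Ext.mk₀ (rightMul r.unop)) (add_zero n)
  one_smul x := by
    have : rightMul (1 : R) = 𝟙 _ := by ext; simp [rightMul]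
    change Abelian.Ext.comp _ (Abelian.Ext.mk₀ (rightMul (1 : R))) _ = _
    rw [this, Abelian.Ext.comp_mk₀_id]
  mul_smul r s x := by
    have : rightMul (s.unop * r.unop) = rightMul s.unop ≫ rightMul r.unop := by
      ext; simp [rightMul]
    change Abelian.Ext.comp _ (Abelian.Ext.mk₀ (rightMul (s.unop * r.unop))) _
      = Abelian.Ext.comp (Abelian.Ext.comp _ _ _) _ _
    rw [this, Abelian.Ext.comp_assoc_of_third_deg_zero, Abelian.Ext.mk₀_comp_mk₀]
  smul_zero r := Abelian.Ext.zero_comp _ _ _ _ _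
  smul_add r x y := Abelian.Ext.add_comp _ _ _ _
  add_smul r s x := by
    have : rightMul (r.unop + s.unop) = rightMul r.unop + rightMul s.unop := by
      ext; simp [rightMul]
    change Abelian.Ext.comp _ (Abelian.Ext.mk₀ (rightMul (r.unop + s.unop))) _
      = Abelian.Ext.comp _ _ _ + Abelian.Ext.comp _ _ _
    rw [this, Abelian.Ext.mk₀_add, Abelian.Ext.comp_add]
  zero_smul x := by
    have : rightMul (0 : R) = 0 := by ext; simp [rightMul]
    change Abelian.Ext.comp _ (Abelian.Ext.mk₀ (rightMul (0 : R))) _ = _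
    rw [this, Abelian.Ext.mk₀_zero, Abelian.Ext.comp_zero]

end Ext

/-! ### Bimodules as modules over the enveloping algebra -/

section Bimodules

open CategoryTheory MulOpposite

variable (k : Type u) [Field k] (A : Type v) [Ring A] [Algebra k A]

/-- The enveloping algebra. A `k`-central `(A, A)`-bimodule is the same as a left module over it,
with `a · m · b = (a ⊗ op b) • m`. -/
abbrev Env : Type v := A ⊗[k] Aᵐᵒᵖ

/-- `A` as a bimodule over itself. -/
instance : Module (Env k A) A := TensorProduct.Algebra.module

theorem env_smul (a b x : A) : (a ⊗ₜ[k] op b : Env k A) • x = a * x * b := by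
  rw [TensorProduct.Algebra.smul_def]
  simp [mul_assoc]

variable {k A}

open scoped ModuleCat.Algebra

/-- The action of an element of the enveloping algebra, as a `k`-linear map. -/
abbrev act (U : ModuleCat.{v} (Env k A)) : Env k A →ₐ[k] Module.End k U :=
  Algebra.lsmul k k U

/-- The relations `u a ⊗ v = u ⊗ a v`. -/
def tensorRel (U V : ModuleCat.{v} (Env k A)) : Submodule k (U ⊗[k] V) :=
  Submodule.span k {x | ∃ (u : U) (a : A) (v : V),
    x = ((1 ⊗ₜ op a : Env k A) • u) ⊗ₜ[k] v - u ⊗ₜ[k] ((a ⊗ₜ 1 : Env k A) • v)}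

/-- The tensor product `U ⊗_A V` of two bimodules. -/
def tensorA (U V : ModuleCat.{v} (Env k A)) : Type v := (U ⊗[k] V) ⧸ tensorRel U V

instance (U V : ModuleCat.{v} (Env k A)) : AddCommGroup (tensorA U V) :=
  inferInstanceAs (AddCommGroup ((U ⊗[k] V) ⧸ tensorRel U V))

instance (U V : ModuleCat.{v} (Env k A)) : Module k (tensorA U V) :=
  inferInstanceAs (Module k ((U ⊗[k] V) ⧸ tensorRel U V))

/-- The class of `u ⊗ v` in `U ⊗_A V`. -/
def tmulA {U V : ModuleCat.{v} (Env k A)} (u : U) (v : V) : tensorA U V :=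
  (tensorRel U V).mkQ (u ⊗ₜ[k] v)

theorem tensorA_hom_ext {U V : ModuleCat.{v} (Env k A)} {f g : Module.End k (tensorA U V)}
    (h : ∀ (u : U) (v : V), f (tmulA u v) = g (tmulA u v)) : f = g := by
  refine Submodule.linearMap_qext (tensorRel U V) (TensorProduct.ext' h)

/-- Left multiplication by `a` on `U ⊗_A V`. -/
def tensorLeft (U V : ModuleCat.{v} (Env k A)) (a : A) : Module.End k (tensorA U V) :=
  (tensorRel U V).mapQ (tensorRel U V)
    (TensorProduct.map (act U (a ⊗ₜ 1)) LinearMap.id) (by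
      refine Submodule.span_le.2 ?_
      rintro _ ⟨u, b, v, rfl⟩
      refine Submodule.subset_span ⟨(a ⊗ₜ 1 : Env k A) • u, b, v, ?_⟩
      simp [smul_smul])

/-- Right multiplication by `b` on `U ⊗_A V`. -/
def tensorRight (U V : ModuleCat.{v} (Env k A)) (b : Aᵐᵒᵖ) : Module.End k (tensorA U V) :=
  (tensorRel U V).mapQ (tensorRel U V)
    (TensorProduct.map LinearMap.id (act V (1 ⊗ₜ b))) (by
      refine Submodule.span_le.2 ?_
      rintro _ ⟨u, a, v, rfl⟩
      refine Submodule.subset_span ⟨u, a, (1 ⊗ₜ b : Env k A) • v, ?_⟩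
      simp [smul_smul])

theorem tensorLeft_tmulA {U V : ModuleCat.{v} (Env k A)} (a : A) (u : U) (v : V) :
    tensorLeft U V a (tmulA u v) = tmulA ((a ⊗ₜ 1 : Env k A) • u) v := rfl

theorem tensorRight_tmulA {U V : ModuleCat.{v} (Env k A)} (b : Aᵐᵒᵖ) (u : U) (v : V) :
    tensorRight U V b (tmulA u v) = tmulA u ((1 ⊗ₜ b : Env k A) • v) := rfl

theorem tmulA_add_left {U V : ModuleCat.{v} (Env k A)} (u u' : U) (v : V) :
    tmulA (u + u') v = tmulA u v + tmulA u' v := by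
  unfold tmulA
  rw [TensorProduct.add_tmul, map_add]
  rfl

theorem tmulA_add_right {U V : ModuleCat.{v} (Env k A)} (u : U) (v v' : V) :
    tmulA u (v + v') = tmulA u v + tmulA u v' := by
  unfold tmulA
  rw [TensorProduct.tmul_add, map_add]
  rfl

theorem tmulA_smul_left {U V : ModuleCat.{v} (Env k A)} (c : k) (u : U) (v : V) :
    tmulA (c • u) v = c • tmulA u v := by
  unfold tmulA
  rw [← TensorProduct.smul_tmul', map_smul]
  rfl

theorem tmulA_smul_right {U V : ModuleCat.{v} (Env k A)} (c : k) (u : U) (v : V) :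
    tmulA u (c • v) = c • tmulA u v := by
  unfold tmulA
  rw [TensorProduct.tmul_smul, map_smul]
  rfl

/-- The action of the enveloping algebra on `U ⊗_A V`. -/
def tensorAct (U V : ModuleCat.{v} (Env k A)) : Env k A →ₐ[k] Module.End k (tensorA U V) :=
  Algebra.TensorProduct.lift
    (AlgHom.ofLinearMap
      { toFun := tensorLeft U V
        map_add' := fun a b => tensorA_hom_ext fun u v => by
          simp [tensorLeft_tmulA, TensorProduct.add_tmul, add_smul, tmulA_add_left]
        map_smul' := fun c a => tensorA_hom_ext fun u v => by
          simp [tensorLeft_tmulA, ← TensorProduct.smul_tmul', smul_assoc, tmulA_smul_left] }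
      (tensorA_hom_ext fun u v => by
        simp [tensorLeft_tmulA, ← Algebra.TensorProduct.one_def])
      (fun a b => tensorA_hom_ext fun u v => by
        simp [tensorLeft_tmulA, smul_smul]))
    (AlgHom.ofLinearMap
      { toFun := tensorRight U V
        map_add' := fun a b => tensorA_hom_ext fun u v => by
          simp [tensorRight_tmulA, TensorProduct.tmul_add, add_smul, tmulA_add_right]
        map_smul' := fun c a => tensorA_hom_ext fun u v => by
          simp [tensorRight_tmulA, smul_assoc, tmulA_smul_right] }
      (tensorA_hom_ext fun u v => by
        simp [tensorRight_tmulA, ← Algebra.TensorProduct.one_def])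
      (fun a b => tensorA_hom_ext fun u v => by
        simp [tensorRight_tmulA, smul_smul]))
    (fun a b => (commute_iff_eq _ _).2 (tensorA_hom_ext fun u v => by
      simp [tensorRight_tmulA, tensorLeft_tmulA]))

instance (U V : ModuleCat.{v} (Env k A)) : Module (Env k A) (tensorA U V) :=
  Module.compHom _ (tensorAct U V).toRingHom

theorem env_smul_tmulA {U V : ModuleCat.{v} (Env k A)} (a b : A) (u : U) (v : V) :
    (a ⊗ₜ op b : Env k A) • tmulA u v
      = tmulA ((a ⊗ₜ 1 : Env k A) • u) ((1 ⊗ₜ op b : Env k A) • v) := by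
  change tensorAct U V (a ⊗ₜ op b) (tmulA u v) = _
  have h : tensorAct U V (a ⊗ₜ op b) = tensorLeft U V a * tensorRight U V (op b) :=
    Algebra.TensorProduct.lift_tmul _ _ _ _ _
  rw [h]
  rfl

/-- Invertible bimodules. -/
def IsInvertible (U : ModuleCat.{v} (Env k A)) : Prop :=
  ∃ V : ModuleCat.{v} (Env k A),
    Nonempty (tensorA U V ≃ₗ[Env k A] A) ∧ Nonempty (tensorA V U ≃ₗ[Env k A] A)

variable (k A)

/-- `A` has a finite resolution by finitely generated projective modules over its enveloping
algebra. -/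
def IsHomologicallySmooth : Prop :=
  ∃ P : ProjectiveResolution (ModuleCat.of (Env k A) A),
    (∀ n, Module.Finite (Env k A) (P.complex.X n)) ∧
    ∃ N : ℕ, ∀ n, N < n → Limits.IsZero (P.complex.X n)

/-- Twisted Calabi–Yau algebras of dimension `d`. The right module `Ext^d` is a bimodule through
`a · x · b = x · (b ⊗ op a)`. -/
def IsTwistedCY (d : ℕ) : Prop :=
  IsHomologicallySmooth k A ∧
  ∃ U : ModuleCat.{v} (Env k A), IsInvertible U ∧
    (∀ i, i ≠ d → Subsingleton (ExtR (ModuleCat.of (Env k A) A) i)) ∧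
    ∃ φ : ExtR (ModuleCat.of (Env k A) A) d ≃+ U,
      ∀ (a b : A) (x : ExtR (ModuleCat.of (Env k A) A) d),
        φ (op (b ⊗ₜ op a : Env k A) • x) = (a ⊗ₜ op b : Env k A) • φ x

end Bimodules

/-! ### Graded bimodules -/

section GradedBimodules

open MulOpposite

variable {k : Type u} [Field k] {A : Type v} [Ring A] [Algebra k A]
variable {G : Type w} [AddCommGroup G] [DecidableEq G]

/-- The grading of the enveloping algebra: degree `γ` is spanned by the `a ⊗ op b` with `a`, `b`
homogeneous of degrees adding up to `γ`. -/
def envGrading (𝒜 : G → Submodule k A) (γ : G) : Submodule k (Env k A) :=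
  Submodule.span k {x | ∃ (i j : G) (a b : A),
    i + j = γ ∧ a ∈ 𝒜 i ∧ b ∈ 𝒜 j ∧ x = a ⊗ₜ[k] op b}

variable (𝒜 : G → Submodule k A) [GradedAlgebra 𝒜]

/-- An element of `A` as the family of its homogeneous components. -/
def comps : A →ₗ[k] (G →₀ A) :=
  DirectSum.toModule k G (G →₀ A) (fun i => Finsupp.lsingle i ∘ₗ (𝒜 i).subtype) ∘ₗ
    (DirectSum.decomposeLinearEquiv 𝒜).toLinearMap

theorem comps_of_mem {i : G} {a : A} (ha : a ∈ 𝒜 i) : comps 𝒜 a = Finsupp.single i a := by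
  lift a to 𝒜 i using ha
  simp [comps]

/-- The projection of the enveloping algebra onto its component of degree `γ`. -/
def envProj (γ : G) : Env k A →ₗ[k] Env k A :=
  Finsupp.lapply γ ∘ₗ Finsupp.lmapDomain (Env k A) k (fun p : G × G => p.1 + p.2) ∘ₗ
    (finsuppTensorFinsupp k k A Aᵐᵒᵖ G G).toLinearMap ∘ₗ
    TensorProduct.map (comps 𝒜)
      (Finsupp.mapRange.linearMap (opLinearEquiv k).toLinearMap ∘ₗ comps 𝒜 ∘ₗ
        (opLinearEquiv k).symm.toLinearMap)

theorem envProj_tmul (γ : G) {i j : G} {a b : A} (ha : a ∈ 𝒜 i) (hb : b ∈ 𝒜 j) :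
    envProj 𝒜 γ (a ⊗ₜ op b) = if i + j = γ then a ⊗ₜ op b else 0 := by
  simp [envProj, comps_of_mem 𝒜 ha, comps_of_mem 𝒜 hb, Finsupp.mapDomain_single,
    Finsupp.single_apply]

theorem envProj_same (γ : G) (x : Env k A) (hx : x ∈ envGrading 𝒜 γ) : envProj 𝒜 γ x = x := by
  induction hx using Submodule.span_induction with
  | mem x h =>
    obtain ⟨i, j, a, b, h, ha, hb, rfl⟩ := h
    rw [envProj_tmul 𝒜 γ ha hb, if_pos h]
  | zero => simp
  | add x y _ _ hx hy => rw [map_add, hx, hy]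
  | smul c x _ hx => rw [map_smul, hx]

theorem envProj_ne (γ δ : G) (hδ : δ ≠ γ) (x : Env k A) (hx : x ∈ envGrading 𝒜 δ) :
    envProj 𝒜 γ x = 0 := by
  induction hx using Submodule.span_induction with
  | mem x h =>
    obtain ⟨i, j, a, b, h, ha, hb, rfl⟩ := h
    rw [envProj_tmul 𝒜 γ ha hb, if_neg (h ▸ hδ)]
  | zero => simp
  | add x y _ _ hx hy => rw [map_add, hx, hy, add_zero]
  | smul c x _ hx => rw [map_smul, hx, smul_zero]

theorem env_iSup : ⨆ γ, (envGrading 𝒜 γ).toAddSubgroup = ⊤ := by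
  classical
  rw [eq_top_iff]
  intro x _
  induction x using TensorProduct.induction_on with
  | zero => exact zero_mem _
  | add x y hx hy => exact add_mem (hx trivial) (hy trivial)
  | tmul a b =>
    rw [← DirectSum.sum_support_decompose 𝒜 a, ← op_unop b,
      ← DirectSum.sum_support_decompose 𝒜 b.unop, Finset.op_sum, TensorProduct.sum_tmul]
    refine sum_mem fun i _ => ?_
    rw [TensorProduct.tmul_sum]
    exact sum_mem fun j _ => AddSubgroup.mem_iSup_of_mem (i + j)
      (Submodule.subset_span ⟨i, j, _, _, rfl, SetLike.coe_mem _, SetLike.coe_mem _, rfl⟩)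

theorem env_isInternal : DirectSum.IsInternal (envGrading 𝒜) :=
  isInternal_of_proj (fun γ => (envGrading 𝒜 γ).toAddSubgroup) (env_iSup 𝒜)
    (fun γ => (envProj 𝒜 γ).toAddMonoidHom) (envProj_same 𝒜) (envProj_ne 𝒜)

instance : GradedAlgebra (envGrading 𝒜) where
  toDecomposition := (env_isInternal 𝒜).chooseDecomposition
  one_mem := Submodule.subset_span ⟨0, 0, 1, 1, add_zero 0, SetLike.GradedOne.one_mem,
    SetLike.GradedOne.one_mem, rfl⟩
  mul_mem := by
    intro γ δ x y hx hy
    refine Submodule.span_induction₂ (p := fun x y _ _ => x * y ∈ envGrading 𝒜 (γ + δ))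
      ?_ ?_ ?_ ?_ ?_ ?_ ?_ hx hy
    · rintro _ _ ⟨i, j, a, b, rfl, ha, hb, rfl⟩ ⟨i', j', a', b', rfl, ha', hb', rfl⟩
      refine Submodule.subset_span ⟨i + i', j' + j, a * a', b' * b, by abel,
        SetLike.GradedMul.mul_mem ha ha', SetLike.GradedMul.mul_mem hb' hb, by simp⟩
    · intro y _; simp
    · intro x _; simp
    · intro x y z _ _ _ h1 h2; rw [add_mul]; exact add_mem h1 h2
    · intro x y z _ _ _ h1 h2; rw [mul_add]; exact add_mem h1 h2
    · intro c x y _ _ h; rw [smul_mul_assoc]; exact Submodule.smul_mem _ _ h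
    · intro c x y _ _ h; rw [mul_smul_comm]; exact Submodule.smul_mem _ _ h

/-- `A` as a graded bimodule over itself. -/
abbrev grSelf : GrMod (envGrading 𝒜) where
  carrier := A
  deg i := (𝒜 i).toAddSubgroup
  isInternal := DirectSum.Decomposition.isInternal 𝒜
  smul_mem := by
    intro γ i r m hr hm
    induction hr using Submodule.span_induction with
    | mem x h =>
      obtain ⟨i', j', a, b, rfl, ha, hb, rfl⟩ := h
      rw [env_smul]
      have := SetLike.GradedMul.mul_mem (SetLike.GradedMul.mul_mem ha hm) hb
      rwa [add_right_comm] at this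
    | zero =>
      have h0 : (0 : Env k A) • m = 0 := zero_smul (Env k A) m
      exact h0 ▸ zero_mem (𝒜 (γ + i))
    | add x y _ _ hx hy => rw [add_smul]; exact add_mem hx hy
    | smul c x _ hx =>
      have h1 : (c • x) • m = c • (x • m) := by
        have : c • x = (algebraMap k A c ⊗ₜ op 1 : Env k A) * x := by
          exact Algebra.smul_def c x
        rw [this, mul_smul, env_smul, mul_one, Algebra.smul_def]
      rw [h1]
      exact (𝒜 (γ + i)).smul_mem c hx

variable {𝒜}

/-- The bimodule underlying a graded bimodule. -/
abbrev GrMod.forget (U : GrMod (envGrading 𝒜)) : ModuleCat.{v} (Env k A) :=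
  ModuleCat.of (Env k A) U.carrier

/-- The grading of `U ⊗_A V`: degree `γ` is spanned by the `u ⊗ v` with `u`, `v` homogeneous of
degrees adding up to `γ`. -/
def tensorDeg (U V : GrMod (envGrading 𝒜)) (γ : G) : AddSubgroup (tensorA U.forget V.forget) :=
  AddSubgroup.closure {x | ∃ (i j : G) (u : U.carrier) (v : V.carrier),
    i + j = γ ∧ u ∈ U.deg i ∧ v ∈ V.deg j ∧ x = tmulA (U := U.forget) (V := V.forget) u v}

/-- Graded invertible graded bimodules. -/
def IsGrInvertible (U : GrMod (envGrading 𝒜)) : Prop :=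
  ∃ V : GrMod (envGrading 𝒜),
    (∃ e : tensorA U.forget V.forget ≃ₗ[Env k A] A, ∀ γ x, x ∈ tensorDeg U V γ ↔ e x ∈ 𝒜 γ) ∧
    (∃ e : tensorA V.forget U.forget ≃ₗ[Env k A] A, ∀ γ x, x ∈ tensorDeg V U γ ↔ e x ∈ 𝒜 γ)

variable (𝒜)

/-- `A` has a finite resolution by finitely generated projectives in the category of graded
modules over its enveloping algebra. -/
def IsGrHomologicallySmooth : Prop :=
  ∃ P : GrProjRes (grSelf 𝒜),
    (∀ n, Module.Finite (Env k A) (P.X n).carrier) ∧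
    ∃ N : ℕ, ∀ n, N < n → Subsingleton (P.X n).carrier

/-- Graded twisted Calabi–Yau algebras of dimension `d`. The right module `Ext^d` is a bimodule
through `a · x · b = x · (b ⊗ op a)`. -/
def IsGrTwistedCY (d : ℕ) : Prop :=
  IsGrHomologicallySmooth 𝒜 ∧
  ∃ U : GrMod (envGrading 𝒜), IsGrInvertible U ∧
    (∀ i, i ≠ d → Subsingleton (grExt (grSelf 𝒜) i)) ∧
    ∃ φ : grExt (grSelf 𝒜) d ≃+ U.carrier,
      (∀ (a b : A) (x : grExt (grSelf 𝒜) d),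
        φ (op (b ⊗ₜ op a : Env k A) • x) = (a ⊗ₜ op b : Env k A) • φ x) ∧
      ∀ γ x, x ∈ grExtDeg (grSelf 𝒜) d γ ↔ φ x ∈ U.deg γ

end GradedBimodules

end GradedCY

end

/-!
A graded module is projective in the graded category exactly when its underlying module is
projective, and on a finitely generated graded module every homomorphism to `A^e` is a sum of
homogeneous ones. Thus a graded resolution by finitely generated projectives computes both kinds of
`Ext`, and the gradings of the `Hom` modules induce one on the ungraded `Ext`. Smoothness does not
depend on the grading because, by Schanuel's lemma, a finite resolution by finitely generated
projectives can be built starting from any graded free cover.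

The invertible bimodule `U ≅ Ext^d` therefore acquires a grading, and it remains to grade an inverse
`V`. The two pairings `U ⊗ V ≃ A` and `V ⊗ U ≃ A` can be normalised to form a Morita context. Then
`U` is finitely generated as a left module and `V ≅ Hom_A(U, A)`, so `V` inherits the grading of
`Hom`; the first pairing is homogeneous by construction, the second one by associativity of the
context and faithfulness of `U` as a right module.
-/

noncomputable section

namespace GradedCY

section Components

theorem exists_sum_of_mem_iSup {ι W : Type*} [AddCommGroup W] {deg : ι → AddSubgroup W}
    {π : ι → W →+ W} (hπ : ∀ i, ∀ x ∈ deg i, π i x = x)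
    (hπ' : ∀ i j, j ≠ i → ∀ x ∈ deg j, π i x = 0) {x : W} (hx : x ∈ ⨆ i, deg i) :
    ∃ s : Finset ι, ∀ t, s ⊆ t → x = ∑ i ∈ t, π i x := by
  classical
  induction hx using AddSubgroup.iSup_induction' with
  | hp i x hx =>
    refine ⟨{i}, fun t ht => ?_⟩
    rw [Finset.sum_eq_single_of_mem i (ht (Finset.mem_singleton_self i)), hπ i x hx]
    exact fun j _ h => hπ' j i h.symm x hx
  | h1 => exact ⟨∅, fun t _ => by simp⟩
  | hadd x y _ _ hx hy =>
    obtain ⟨s, hs⟩ := hx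
    obtain ⟨s', hs'⟩ := hy
    refine ⟨s ∪ s', fun t ht => ?_⟩
    simp only [map_add, Finset.sum_add_distrib]
    rw [← hs t (Finset.union_subset_left ht), ← hs' t (Finset.union_subset_right ht)]

variable {k : Type u} [Field k] {G : Type w} [AddCommGroup G] [DecidableEq G]
variable {R : Type v} [Ring R] [Algebra k R] {𝓡 : G → Submodule k R}

theorem isGrHom_id (M : GrMod 𝓡) : IsGrHom M M LinearMap.id :=
  fun _ _ hm => hm

@[elab_as_elim]
theorem GrMod.homogeneous_induction (M : GrMod 𝓡) {p : M.carrier → Prop} (x : M.carrier)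
    (mem : ∀ i, ∀ m ∈ M.deg i, p m) (zero : p 0) (add : ∀ x y, p x → p y → p (x + y)) : p x :=
  AddSubgroup.iSup_induction M.deg (C := p) (M.iSup_deg ▸ AddSubgroup.mem_top x) mem zero add

theorem linearMap_ext_homogeneous {M : GrMod 𝓡} {N : Type*} [AddCommGroup N] [Module R N]
    {f g : M.carrier →ₗ[R] N} (h : ∀ i, ∀ m ∈ M.deg i, f m = g m) : f = g := by
  ext x
  refine M.homogeneous_induction x h ?_ (fun x y hx hy => ?_)
  · rw [map_zero, map_zero]
  · rw [map_add, map_add, hx, hy]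

theorem GrMod.exists_sum_proj_of_subset (M : GrMod 𝓡) (x : M.carrier) :
    ∃ s : Finset G, ∀ t, s ⊆ t → x = ∑ i ∈ t, M.proj i x :=
  exists_sum_of_mem_iSup M.proj_same M.proj_ne (M.iSup_deg ▸ AddSubgroup.mem_top x)

theorem GrMod.proj_smul_of_mem (M : GrMod 𝓡) {i : G} {r : R} (hr : r ∈ 𝓡 i) (j : G)
    (x : M.carrier) : M.proj (i + j) (r • x) = r • M.proj j x := by
  refine M.homogeneous_induction x (fun l m hm => ?_) ?_ (fun x y hx hy => ?_)
  · by_cases h : l = j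
    · subst h
      rw [M.proj_same _ _ hm, M.proj_same _ _ (M.smul_mem hr hm)]
    · rw [M.proj_ne _ _ h _ hm, smul_zero,
        M.proj_ne _ _ (fun h' => h (add_left_cancel h')) _ (M.smul_mem hr hm)]
  · rw [smul_zero, map_zero, map_zero, smul_zero]
  · rw [smul_add, map_add, hx, hy, map_add, smul_add]

theorem GrMod.exists_homogeneous_generators (M : GrMod 𝓡) [Module.Finite R M.carrier] :
    ∃ s : Finset M.carrier, (∀ m ∈ s, ∃ i, m ∈ M.deg i) ∧
      Submodule.span R (s : Set M.carrier) = ⊤ := by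
  classical
  obtain ⟨t, ht⟩ := Module.Finite.fg_top (R := R) (M := M.carrier)
  choose degrees hdegrees using M.exists_sum_proj
  refine ⟨t.biUnion fun x => (degrees x).image fun i => M.proj i x, ?_, ?_⟩
  · intro m hm
    simp only [Finset.mem_biUnion, Finset.mem_image] at hm
    obtain ⟨x, _, i, _, rfl⟩ := hm
    exact ⟨i, M.proj_mem _ _⟩
  · rw [eq_top_iff, ← ht, Submodule.span_le]
    intro x hx
    rw [hdegrees x]
    refine sum_mem fun i hi => Submodule.subset_span ?_
    simp only [Finset.coe_biUnion, Set.mem_iUnion, Finset.mem_coe, Finset.mem_image]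
    exact ⟨x, hx, i, hi, rfl⟩

/-- The component of degree `τ` of an additive map between graded modules: on elements of degree
`σ` it is the map followed by the projection onto degree `σ + τ`. -/
def addComponent {M N : GrMod 𝓡} (f : M.carrier →+ N.carrier) (τ : G) :
    M.carrier →+ N.carrier :=
  letI := M.isInternal.chooseDecomposition
  (DirectSum.toAddMonoid fun σ => ((N.proj (σ + τ)).comp f).comp (M.deg σ).subtype).comp
    (DirectSum.decomposeAddEquiv M.deg).toAddMonoidHom

theorem addComponent_of_mem {M N : GrMod 𝓡} (f : M.carrier →+ N.carrier) (τ : G) {σ : G}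
    {m : M.carrier} (hm : m ∈ M.deg σ) : addComponent f τ m = N.proj (σ + τ) (f m) := by
  let _ := M.isInternal.chooseDecomposition
  change (DirectSum.toAddMonoid fun σ => ((N.proj (σ + τ)).comp f).comp (M.deg σ).subtype)
    (DirectSum.decompose M.deg m) = _
  rw [DirectSum.decompose_of_mem M.deg hm, DirectSum.toAddMonoid_of]
  rfl

theorem addComponent_smul_of_mem {M N : GrMod 𝓡} (f : M.carrier →ₗ[R] N.carrier) (τ : G) {i : G}
    {r : R} (hr : r ∈ 𝓡 i) (m : M.carrier) :
    addComponent f.toAddMonoidHom τ (r • m) = r • addComponent f.toAddMonoidHom τ m := by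
  refine M.homogeneous_induction m (fun σ m hm => ?_) ?_ (fun x y hx hy => ?_)
  · rw [addComponent_of_mem _ _ hm, addComponent_of_mem _ _ (M.smul_mem hr hm), add_assoc,
      ← N.proj_smul_of_mem hr]
    exact congrArg _ (map_smul f r m)
  · rw [smul_zero, map_zero, smul_zero]
  · rw [smul_add, map_add, hx, hy, map_add, smul_add]

variable [GradedAlgebra 𝓡]

/-- The component of degree `τ` of a homomorphism between graded modules. -/
def homComponent {M N : GrMod 𝓡} (f : M.carrier →ₗ[R] N.carrier) (τ : G) :
    M.carrier →ₗ[R] N.carrier where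
  toFun := addComponent f.toAddMonoidHom τ
  map_add' := map_add _
  map_smul' r m := by
    induction r using DirectSum.Decomposition.inductionOn 𝓡 with
    | zero => rw [zero_smul, map_zero, map_zero, zero_smul]
    | homogeneous r => exact addComponent_smul_of_mem f τ r.2 m
    | add r s hr hs => rw [add_smul, map_add, hr, hs, map_add, add_smul]

theorem homComponent_of_mem {M N : GrMod 𝓡} (f : M.carrier →ₗ[R] N.carrier) (τ : G) {σ : G}
    {m : M.carrier} (hm : m ∈ M.deg σ) : homComponent f τ m = N.proj (σ + τ) (f m) :=
  addComponent_of_mem _ _ hm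

theorem homComponent_mem {M N : GrMod 𝓡} (f : M.carrier →ₗ[R] N.carrier) (τ : G) {σ : G}
    {m : M.carrier} (hm : m ∈ M.deg σ) : homComponent f τ m ∈ N.deg (σ + τ) := by
  rw [homComponent_of_mem f τ hm]
  exact N.proj_mem _ _

theorem isGrHom_homComponent_zero {M N : GrMod 𝓡} (f : M.carrier →ₗ[R] N.carrier) :
    IsGrHom M N (homComponent f 0) :=
  fun σ m hm => by simpa using homComponent_mem f 0 hm

theorem homComponent_add {M N : GrMod 𝓡} (f g : M.carrier →ₗ[R] N.carrier) (τ : G) :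
    homComponent (f + g) τ = homComponent f τ + homComponent g τ :=
  linearMap_ext_homogeneous fun i m hm => by simp [homComponent_of_mem _ _ hm]

theorem homComponent_comp {M M' N : GrMod 𝓡} (f : M.carrier →ₗ[R] N.carrier)
    {g : M'.carrier →ₗ[R] M.carrier} (hg : IsGrHom M' M g) (τ : G) :
    homComponent (f ∘ₗ g) τ = homComponent f τ ∘ₗ g :=
  linearMap_ext_homogeneous fun i m hm => by
    simp [homComponent_of_mem _ _ hm, homComponent_of_mem _ _ (hg i m hm)]

theorem comp_homComponent {M N N' : GrMod 𝓡} (f : M.carrier →ₗ[R] N.carrier)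
    {g : N.carrier →ₗ[R] N'.carrier} (hg : IsGrHom N N' g) (τ : G) :
    homComponent (g ∘ₗ f) τ = g ∘ₗ homComponent f τ :=
  linearMap_ext_homogeneous fun i m hm => by
    simp [homComponent_of_mem _ _ hm, hg.map_proj]

theorem homComponent_same {M N : GrMod 𝓡} {f : M.carrier →ₗ[R] N.carrier} {τ : G}
    (hf : ∀ σ, ∀ m ∈ M.deg σ, f m ∈ N.deg (σ + τ)) : homComponent f τ = f :=
  linearMap_ext_homogeneous fun i m hm => by
    rw [homComponent_of_mem _ _ hm, N.proj_same _ _ (hf i m hm)]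

theorem homComponent_ne {M N : GrMod 𝓡} {f : M.carrier →ₗ[R] N.carrier} {τ τ' : G} (h : τ' ≠ τ)
    (hf : ∀ σ, ∀ m ∈ M.deg σ, f m ∈ N.deg (σ + τ')) : homComponent f τ = 0 :=
  linearMap_ext_homogeneous fun i m hm => by
    rw [homComponent_of_mem _ _ hm, N.proj_ne _ (i + τ') (by simpa using h) _ (hf i m hm),
      LinearMap.zero_apply]

theorem IsGrHom.homComponent_zero {M N : GrMod 𝓡} {f : M.carrier →ₗ[R] N.carrier}
    (hf : IsGrHom M N f) : homComponent f 0 = f :=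
  homComponent_same fun σ m hm => by simpa using hf σ m hm

theorem exists_sum_homComponent {M N : GrMod 𝓡} [Module.Finite R M.carrier]
    (f : M.carrier →ₗ[R] N.carrier) : ∃ s : Finset G, f = ∑ τ ∈ s, homComponent f τ := by
  classical
  obtain ⟨gens, hgens, hspan⟩ := M.exists_homogeneous_generators
  choose! e he using hgens
  choose degrees hdegrees using fun m => N.exists_sum_proj_of_subset (f m)
  let s := gens.biUnion fun m => (degrees m).image fun i => -e m + i
  refine ⟨s, LinearMap.ext_on hspan fun m hm => ?_⟩
  have hdeg : degrees m ⊆ s.image fun i => e m + i := fun i hi =>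
    Finset.mem_image.2 ⟨-e m + i, Finset.mem_biUnion.2 ⟨m, hm, Finset.mem_image_of_mem _ hi⟩,
      add_neg_cancel_left _ _⟩
  rw [LinearMap.sum_apply, hdegrees m _ hdeg,
    Finset.sum_image (fun x _ y _ h => add_left_cancel h)]
  exact Finset.sum_congr rfl fun τ _ => (homComponent_of_mem f τ (he m hm)).symm

end Components

/-! ### Graded projective modules -/

section Projective

variable {k : Type u} [Field k] {G : Type w} [AddCommGroup G] [DecidableEq G]
variable {R : Type v} [Ring R] [Algebra k R] {𝓡 : G → Submodule k R} [GradedAlgebra 𝓡]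

theorem GrMod.exists_free_cover (M : GrMod 𝓡) {ι : Type v} (x : ι → M.carrier) (e : ι → G)
    (hx : ∀ i, x i ∈ M.deg (e i)) (hspan : Submodule.span R (Set.range x) = ⊤) :
    ∃ p : (GrMod.free 𝓡 ι e).carrier →ₗ[R] M.carrier,
      IsGrHom (GrMod.free 𝓡 ι e) M p ∧ Function.Surjective p := by
  classical
  let p : (Π₀ _ : ι, R) →ₗ[R] M.carrier :=
    DFinsupp.lsum ℕ fun i => LinearMap.toSpanSingleton R M.carrier (x i)
  refine ⟨p, fun γ f hf => ?_, ?_⟩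
  · have hp : p f = f.sum fun i r => r • x i := DFinsupp.sumAddHom_apply _ f
    rw [hp]
    refine sum_mem fun i _ => ?_
    simpa using M.smul_mem (hf i) (hx i)
  · rw [← LinearMap.range_eq_top, eq_top_iff, ← hspan, Submodule.span_le]
    rintro _ ⟨i, rfl⟩
    exact ⟨DFinsupp.single i (1 : R), by simp [p]⟩

theorem IsGrProjective.projective {P : GrMod 𝓡} (hP : IsGrProjective P) :
    Module.Projective R P.carrier := by
  classical
  let ι : Type v := {m : P.carrier // ∃ i, m ∈ P.deg i}
  have hspan : Submodule.span R (Set.range (Subtype.val : ι → P.carrier)) = ⊤ := by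
    refine eq_top_iff.2 fun x _ => P.homogeneous_induction x
      (fun i m hm => Submodule.subset_span ⟨⟨m, i, hm⟩, rfl⟩) (zero_mem _)
      (fun x y hx hy => add_mem hx hy)
  obtain ⟨p, hp, hsurj⟩ := P.exists_free_cover (ι := ι) Subtype.val (fun m => m.2.choose)
    (fun m => m.2.choose_spec) hspan
  obtain ⟨s, -, hs⟩ := hP _ _ p LinearMap.id hp hsurj (isGrHom_id P)
  have : Module.Projective R (Π₀ _ : ι, R) := inferInstance
  exact Module.Projective.of_split s p hs

theorem isGrProjective_of_projective (P : GrMod 𝓡) [Module.Projective R P.carrier] :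
    IsGrProjective P := by
  intro X Y q g hq hsurj hg
  obtain ⟨h, hh⟩ := Module.projective_lifting_property q g hsurj
  refine ⟨homComponent h 0, isGrHom_homComponent_zero h, ?_⟩
  rw [← comp_homComponent h hq, hh, hg.homComponent_zero]

theorem GrMod.exists_finite_cover (M : GrMod 𝓡) [Module.Finite R M.carrier] :
    ∃ (F : GrMod 𝓡) (p : F.carrier →ₗ[R] M.carrier), IsGrProjective F ∧
      Module.Finite R F.carrier ∧ IsGrHom F M p ∧ Function.Surjective p := by
  classical
  obtain ⟨s, hs, hspan⟩ := M.exists_homogeneous_generators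
  choose e he using hs
  obtain ⟨p, hp, hsurj⟩ := M.exists_free_cover (ι := {m // m ∈ s}) Subtype.val
    (fun m => e m.1 m.2) (fun m => he m.1 m.2) (by simpa using hspan)
  refine ⟨_, p, GrMod.free_isGrProjective _ _, ?_, hp, hsurj⟩
  exact Module.Finite.equiv (DFinsupp.linearEquivFunOnFintype (R := R)
    (M := fun _ : {m // m ∈ s} => R)).symm

end Projective

section Subquotient

variable {S W : Type*} [Ring S] [AddCommGroup W] [Module S W] {Z B : Submodule S W}

theorem Subquotient.mk_surjective : Function.Surjective (Subquotient.mk Z B) :=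
  Submodule.mkQ_surjective _

theorem Subquotient.mk_eq_zero_iff {z : Z} : Subquotient.mk Z B z = 0 ↔ z.1 ∈ B :=
  Submodule.Quotient.mk_eq_zero _

/-- The additive endomorphism of a subquotient induced by an additive endomorphism. -/
def Subquotient.addMap (f : W →+ W) (hZ : ∀ x ∈ Z, f x ∈ Z) (hB : ∀ x ∈ B, f x ∈ B) :
    Subquotient Z B →+ Subquotient Z B :=
  QuotientAddGroup.map (B.submoduleOf Z).toAddSubgroup (B.submoduleOf Z).toAddSubgroup
    (AddMonoidHom.mk' (fun z : Z => (⟨f z.1, hZ z.1 z.2⟩ : Z)) fun x y => Subtype.ext (by simp))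
    fun x hx => hB x.1 hx

theorem Subquotient.addMap_mk (f : W →+ W) (hZ : ∀ x ∈ Z, f x ∈ Z) (hB : ∀ x ∈ B, f x ∈ B)
    (z : Z) : Subquotient.addMap f hZ hB (Subquotient.mk Z B z) =
      Subquotient.mk Z B ⟨f z.1, hZ z.1 z.2⟩ :=
  rfl

end Subquotient

/-! ### The grading of `HOM(M, R)` and of its derived functors -/

section TotalHom

variable {k : Type u} [Field k] {G : Type w} [AddCommGroup G] [DecidableEq G]
variable {R : Type v} [Ring R] [Algebra k R] {𝓡 : G → Submodule k R} [GradedAlgebra 𝓡]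

variable (𝓡) in
/-- The graded algebra as a graded left module over itself. -/
abbrev GrMod.regular : GrMod 𝓡 where
  carrier := R
  deg i := (𝓡 i).toAddSubgroup
  isInternal := DirectSum.Decomposition.isInternal 𝓡
  smul_mem hr hm := SetLike.GradedMul.mul_mem hr hm

/-- The component of degree `τ` of a homomorphism into the algebra. -/
def dualComponent (M : GrMod 𝓡) (τ : G) : (M.carrier →ₗ[R] R) →+ (M.carrier →ₗ[R] R) :=
  AddMonoidHom.mk' (fun f => homComponent (N := GrMod.regular 𝓡) f τ)
    (fun f g => homComponent_add (N := GrMod.regular 𝓡) f g τ)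

theorem dualComponent_mem (M : GrMod 𝓡) (τ : G) (f : M.carrier →ₗ[R] R) :
    dualComponent M τ f ∈ homDeg M τ :=
  fun _ _ hm => homComponent_mem (N := GrMod.regular 𝓡) f τ hm

theorem dualComponent_same {M : GrMod 𝓡} (τ : G) (f : M.carrier →ₗ[R] R) (hf : f ∈ homDeg M τ) :
    dualComponent M τ f = f :=
  homComponent_same (N := GrMod.regular 𝓡) hf

theorem dualComponent_ne {M : GrMod 𝓡} (τ τ' : G) (h : τ' ≠ τ) (f : M.carrier →ₗ[R] R)
    (hf : f ∈ homDeg M τ') : dualComponent M τ f = 0 :=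
  homComponent_ne (N := GrMod.regular 𝓡) h hf

theorem dualComponent_precomp {M N : GrMod 𝓡} {g : M.carrier →ₗ[R] N.carrier}
    (hg : IsGrHom M N g) (τ : G) (f : N.carrier →ₗ[R] R) :
    dualComponent M τ (precomp g f) = precomp g (dualComponent N τ f) :=
  homComponent_comp (N := GrMod.regular 𝓡) f hg τ

theorem homDeg_le_totalHom (M : GrMod 𝓡) (τ : G) : homDeg M τ ≤ (totalHom M).toAddSubgroup :=
  le_iSup (homDeg M) τ

theorem precomp_mem_totalHom {M N : GrMod 𝓡} {g : M.carrier →ₗ[R] N.carrier}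
    (hg : IsGrHom M N g) {f : N.carrier →ₗ[R] R} (hf : f ∈ totalHom N) :
    precomp g f ∈ totalHom M :=
  AddSubgroup.iSup_induction (homDeg N) (C := fun f => precomp g f ∈ totalHom M) hf
    (fun τ _ hf => homDeg_le_totalHom M τ fun σ m hm => hf σ _ (hg σ m hm))
    (by rw [map_zero]; exact zero_mem _)
    (fun f f' hf hf' => by rw [map_add]; exact add_mem hf hf')

theorem exists_sum_dualComponent {M : GrMod 𝓡} {f : M.carrier →ₗ[R] R} (hf : f ∈ totalHom M) :
    ∃ s : Finset G, f = ∑ τ ∈ s, dualComponent M τ f := by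
  obtain ⟨s, hs⟩ := exists_sum_of_mem_iSup (deg := homDeg M) dualComponent_same dualComponent_ne hf
  exact ⟨s, hs s subset_rfl⟩

theorem iSup_homDeg_eq_top (M : GrMod 𝓡) [Module.Finite R M.carrier] : ⨆ τ, homDeg M τ = ⊤ := by
  refine eq_top_iff.2 fun f _ => ?_
  obtain ⟨s, hs⟩ := exists_sum_homComponent (N := GrMod.regular 𝓡) f
  rw [hs]
  exact sum_mem fun τ _ => AddSubgroup.mem_iSup_of_mem τ (dualComponent_mem M τ f)

theorem totalHom_eq_top (M : GrMod 𝓡) [Module.Finite R M.carrier] : totalHom M = ⊤ :=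
  Submodule.toAddSubgroup_injective (iSup_homDeg_eq_top M)

theorem homDeg_isInternal (M : GrMod 𝓡) [Module.Finite R M.carrier] :
    DirectSum.IsInternal (homDeg M) :=
  isInternal_of_proj _ (iSup_homDeg_eq_top M) (dualComponent M) dualComponent_same
    dualComponent_ne

end TotalHom

section Cohomology

variable {k : Type u} [Field k] {G : Type w} [AddCommGroup G] [DecidableEq G]
variable {R : Type v} [Ring R] [Algebra k R] {𝓡 : G → Submodule k R} [GradedAlgebra 𝓡]
variable {M : GrMod 𝓡}

namespace GrProjRes

variable (P : GrProjRes M)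

theorem dualComponent_mem_cocycles (n : ℕ) (τ : G) (f : (P.X n).carrier →ₗ[R] R)
    (hf : f ∈ P.cocycles n) : dualComponent (P.X n) τ f ∈ P.cocycles n := by
  refine ⟨homDeg_le_totalHom _ τ (dualComponent_mem _ τ f), ?_⟩
  rw [SetLike.mem_coe, LinearMap.mem_ker, ← dualComponent_precomp (P.d_graded n),
    LinearMap.mem_ker.1 hf.2, map_zero]

theorem dualComponent_mem_coboundaries (n : ℕ) (τ : G) (f : (P.X n).carrier →ₗ[R] R)
    (hf : f ∈ P.coboundaries n) : dualComponent (P.X n) τ f ∈ P.coboundaries n := by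
  cases n with
  | zero =>
    rw [(Submodule.mem_bot _).1 hf, map_zero]
    exact zero_mem _
  | succ n =>
    obtain ⟨g, -, rfl⟩ := hf
    rw [dualComponent_precomp (P.d_graded n)]
    exact ⟨_, homDeg_le_totalHom _ τ (dualComponent_mem _ τ g), rfl⟩

theorem cohomology_isInternal (n : ℕ) : DirectSum.IsInternal (P.cohomologyDeg n) := by
  refine isInternal_of_proj _ ?_ (fun τ => Subquotient.addMap (dualComponent (P.X n) τ)
    (P.dualComponent_mem_cocycles n τ) (P.dualComponent_mem_coboundaries n τ)) ?_ ?_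
  · refine eq_top_iff.2 fun x _ => ?_
    obtain ⟨z, rfl⟩ := Subquotient.mk_surjective x
    obtain ⟨s, hs⟩ := exists_sum_dualComponent z.2.1
    have hz : z = ∑ τ ∈ s, (⟨dualComponent (P.X n) τ z.1,
        P.dualComponent_mem_cocycles n τ z.1 z.2⟩ : P.cocycles n) :=
      Subtype.ext (by simpa using hs)
    rw [hz, map_sum]
    exact sum_mem fun τ _ => AddSubgroup.mem_iSup_of_mem τ ⟨_, dualComponent_mem _ τ z.1, rfl⟩
  · rintro τ _ ⟨z, hz, rfl⟩
    rw [Subquotient.addMap_mk]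
    exact congrArg _ (Subtype.ext (dualComponent_same τ z.1 hz))
  · rintro τ τ' h _ ⟨z, hz, rfl⟩
    rw [Subquotient.addMap_mk, Subquotient.mk_eq_zero_iff]
    simp only [dualComponent_ne τ τ' h z.1 hz, zero_mem]

theorem op_smul_mem_cohomologyDeg (n : ℕ) {i τ : G} {r : R} (hr : r ∈ 𝓡 i) {x : P.cohomology n}
    (hx : x ∈ P.cohomologyDeg n τ) : MulOpposite.op r • x ∈ P.cohomologyDeg n (τ + i) := by
  obtain ⟨z, hz, rfl⟩ := hx
  refine ⟨MulOpposite.op r • z, fun σ m hm => ?_, map_smul _ _ _⟩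
  rw [← add_assoc]
  exact SetLike.GradedMul.mul_mem (hz σ m hm) hr

end GrProjRes

end Cohomology

/-! ### Comparison of graded and ungraded `Ext` -/

section Resolution

open CategoryTheory

variable {R : Type v} [Ring R]

/-- The chain complex of a sequence of linear maps with vanishing composites. -/
def chainComplexOf (X : ℕ → Type v) [∀ n, AddCommGroup (X n)] [∀ n, Module R (X n)]
    (d : ∀ n, X (n + 1) →ₗ[R] X n) (hd : ∀ n, d n ∘ₗ d (n + 1) = 0) :
    ChainComplex (ModuleCat.{v} R) ℕ :=
  ChainComplex.of (fun n => ModuleCat.of R (X n)) (fun n => ModuleCat.ofHom (d n))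
    fun n => ModuleCat.hom_ext (hd n)

variable {X : ℕ → Type v} [∀ n, AddCommGroup (X n)] [∀ n, Module R (X n)]
  {d : ∀ n, X (n + 1) →ₗ[R] X n} {M : Type v} [AddCommGroup M] [Module R M]

theorem chainComplexOf_d (hd : ∀ n, d n ∘ₗ d (n + 1) = 0) (n : ℕ) :
    (chainComplexOf X d hd).d (n + 1) n = ModuleCat.ofHom (d n) :=
  ChainComplex.of_d (fun n => ModuleCat.of R (X n)) (fun n => ModuleCat.ofHom (d n)) n

theorem chainComplexOf_exactAt_succ (hd : ∀ n, d n ∘ₗ d (n + 1) = 0) {n : ℕ}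
    (hex : Function.Exact (d (n + 1)) (d n)) : (chainComplexOf X d hd).ExactAt (n + 1) := by
  rw [HomologicalComplex.exactAt_iff' _ (n + 1 + 1) (n + 1) n (by simp) (by simp),
    ShortComplex.ShortExact.moduleCat_exact_iff_function_exact]
  change Function.Exact ((chainComplexOf X d hd).d (n + 1 + 1) (n + 1))
    ((chainComplexOf X d hd).d (n + 1) n)
  rwa [chainComplexOf_d, chainComplexOf_d]

/-- The augmentation of the chain complex of a sequence of linear maps. -/
def chainComplexAugmentation (hd : ∀ n, d n ∘ₗ d (n + 1) = 0) (ε : X 0 →ₗ[R] M)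
    (hε : ε ∘ₗ d 0 = 0) :
    chainComplexOf X d hd ⟶ (ChainComplex.single₀ _).obj (ModuleCat.of R M) :=
  (ChainComplex.toSingle₀Equiv _ _).symm ⟨ModuleCat.ofHom ε, by
    rw [chainComplexOf_d]
    exact ModuleCat.hom_ext hε⟩

theorem chainComplexAugmentation_f_zero (hd : ∀ n, d n ∘ₗ d (n + 1) = 0) (ε : X 0 →ₗ[R] M)
    (hε : ε ∘ₗ d 0 = 0) : (chainComplexAugmentation hd ε hε).f 0 = ModuleCat.ofHom ε :=
  ChainComplex.toSingle₀Equiv_symm_apply_f_zero (C := chainComplexOf X d hd)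
    (X := ModuleCat.of R M) (ModuleCat.ofHom ε) _

theorem quasiIsoAt_zero_chainComplexAugmentation (hd : ∀ n, d n ∘ₗ d (n + 1) = 0)
    (ε : X 0 →ₗ[R] M) (hsurj : Function.Surjective ε) (h0 : Function.Exact (d 0) ε) :
    QuasiIsoAt (chainComplexAugmentation hd ε h0.linearMap_comp_eq_zero) 0 := by
  rw [ChainComplex.quasiIsoAt₀_iff, ShortComplex.quasiIso_iff_of_zeros']
  · have hz : ModuleCat.ofHom (d 0) ≫ ModuleCat.ofHom ε = 0 :=
      ModuleCat.hom_ext h0.linearMap_comp_eq_zero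
    have hexact : (ShortComplex.mk _ _ hz).Exact ∧ Epi (ModuleCat.ofHom ε) :=
      ⟨(ShortComplex.ShortExact.moduleCat_exact_iff_function_exact _).2 h0,
        (ModuleCat.epi_iff_surjective _).2 hsurj⟩
    refine (ShortComplex.exact_and_epi_g_iff_of_iso ?_).2 hexact
    refine ShortComplex.isoMk (Iso.refl _) (Iso.refl _) (Iso.refl _) ?_ ?_
    · exact (Category.id_comp _).trans
        ((chainComplexOf_d hd 0).symm.trans (Category.comp_id _).symm)
    · exact (Category.id_comp _).trans
        ((chainComplexAugmentation_f_zero hd ε h0.linearMap_comp_eq_zero).symm.trans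
          (Category.comp_id _).symm)
  all_goals rfl

/-- An exact sequence of projective modules ending in `M` as a projective resolution. -/
def projectiveResolutionOfExact (ε : X 0 →ₗ[R] M) (hP : ∀ n, Module.Projective R (X n))
    (hsurj : Function.Surjective ε) (h0 : Function.Exact (d 0) ε)
    (hex : ∀ n, Function.Exact (d (n + 1)) (d n)) :
    ProjectiveResolution (ModuleCat.of R M) where
  complex := chainComplexOf X d fun n => (hex n).linearMap_comp_eq_zero
  projective n := (IsProjective.iff_projective (R := R) (X n)).1 (hP n)
  π := chainComplexAugmentation _ ε h0.linearMap_comp_eq_zero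
  quasiIso := ⟨fun n => by
    cases n with
    | zero => exact quasiIsoAt_zero_chainComplexAugmentation _ ε hsurj h0
    | succ n =>
      rw [quasiIsoAt_iff_exactAt' _ _ (ChainComplex.exactAt_succ_single_obj _ _)]
      exact chainComplexOf_exactAt_succ _ (hex n)⟩

end Resolution

section ExtZero

open CategoryTheory CochainComplex.HomComplex Abelian

variable {C : Type u} [Category.{v} C] [Abelian C] [HasExt.{w} C]
  {X Y : C} (P : ProjectiveResolution X)

theorem extMk_zero_eq_zero_iff (f : P.complex.X 0 ⟶ Y) (hf : P.complex.d 1 0 ≫ f = 0) :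
    P.extMk f 1 rfl hf = 0 ↔ f = 0 := by
  simp only [← P.extEquivCohomologyClass.apply_eq_iff_eq,
    ProjectiveResolution.extEquivCohomologyClass_extMk,
    ProjectiveResolution.extEquivCohomologyClass_zero, CohomologyClass.mk_eq_zero_iff]
  rw [Cocycle.toSingleMk_mem_coboundaries_iff _ _ _ _ _ 1 (by simp)]
  have hX₁ : Limits.IsZero (P.cochainComplex.X 1) :=
    CochainComplex.isZero_of_isStrictlyLE _ 0 _ (by simp)
  constructor
  · rintro ⟨g, hg⟩
    rw [hX₁.eq_of_src g 0, Limits.comp_zero] at hg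
    rw [← cancel_epi (P.cochainComplexXIso (-(0 : ℕ)) 0 rfl).hom, ← hg, Limits.comp_zero]
  · rintro rfl
    exact ⟨0, by simp⟩

end ExtZero

section ExtComparison

open CategoryTheory

variable {k : Type u} [Field k] {G : Type w} [AddCommGroup G] [DecidableEq G]
variable {R : Type v} [Ring R] [Algebra k R] {𝓡 : G → Submodule k R} [GradedAlgebra 𝓡]
variable {M : GrMod 𝓡}

namespace GrProjRes

/-- The projective resolution underlying a graded resolution. -/
def toProjectiveResolution (P : GrProjRes M) : ProjectiveResolution (ModuleCat.of R M.carrier) :=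
  projectiveResolutionOfExact (X := fun n => (P.X n).carrier) (d := P.d) P.ε
    (fun n => (P.projective n).projective) P.ε_surjective P.exact_zero P.exact_succ

variable (P Q : GrProjRes M)

theorem toProjectiveResolution_d (n : ℕ) :
    P.toProjectiveResolution.complex.d (n + 1) n = ModuleCat.ofHom (P.d n) :=
  chainComplexOf_d (fun n => (P.exact_succ n).linearMap_comp_eq_zero) n

theorem toProjectiveResolution_π_f_zero :
    P.toProjectiveResolution.π.f 0 = ModuleCat.ofHom P.ε :=
  chainComplexAugmentation_f_zero (X := fun n => (P.X n).carrier) (d := P.d)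
    (fun n => (P.exact_succ n).linearMap_comp_eq_zero) P.ε P.exact_zero.linearMap_comp_eq_zero

theorem exists_gradedLift : ∃ φ : ∀ n, (P.X n).carrier →ₗ[R] (Q.X n).carrier,
    (∀ n, IsGrHom (P.X n) (Q.X n) (φ n)) ∧ Q.ε ∘ₗ φ 0 = P.ε ∧
      ∀ n, Q.d n ∘ₗ φ (n + 1) = φ n ∘ₗ P.d n := by
  let lift := ProjectiveResolution.lift (𝟙 _) P.toProjectiveResolution Q.toProjectiveResolution
  let ψ (n : ℕ) : (P.X n).carrier →ₗ[R] (Q.X n).carrier := (lift.f n).hom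
  have hε : Q.ε ∘ₗ ψ 0 = P.ε := by
    have := ProjectiveResolution.lift_commutes_zero (𝟙 _) P.toProjectiveResolution
      Q.toProjectiveResolution
    rw [toProjectiveResolution_π_f_zero, toProjectiveResolution_π_f_zero] at this
    exact congrArg ModuleCat.Hom.hom (this.trans (Category.comp_id _))
  have hd (n : ℕ) : Q.d n ∘ₗ ψ (n + 1) = ψ n ∘ₗ P.d n := by
    have := lift.comm (n + 1) n
    rw [toProjectiveResolution_d, toProjectiveResolution_d] at this
    exact congrArg ModuleCat.Hom.hom this
  refine ⟨fun n => homComponent (ψ n) 0, fun n => isGrHom_homComponent_zero _, ?_, fun n => ?_⟩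
  · rw [← comp_homComponent _ Q.ε_graded, hε, P.ε_graded.homComponent_zero]
  · rw [← comp_homComponent _ (Q.d_graded n), hd, homComponent_comp _ (P.d_graded n)]

/-- A homomorphism into the algebra as a morphism out of the underlying resolution. -/
def cochain {n : ℕ} (f : (P.X n).carrier →ₗ[R] R) :
    P.toProjectiveResolution.complex.X n ⟶ ModuleCat.of R R :=
  ModuleCat.ofHom f

theorem d_comp_cochain {n : ℕ} {f : (P.X n).carrier →ₗ[R] R} (hf : precomp (P.d n) f = 0) :
    P.toProjectiveResolution.complex.d (n + 1) n ≫ P.cochain f = 0 := by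
  rw [toProjectiveResolution_d]
  exact ModuleCat.hom_ext hf

/-- The class in `Ext` of a cocycle. -/
def extClass (n : ℕ) : P.cocycles n →ₗ[Rᵐᵒᵖ] ExtR (ModuleCat.of R M.carrier) n where
  toFun z := P.toProjectiveResolution.extMk (P.cochain z.1) (n + 1) rfl (P.d_comp_cochain z.2.2)
  map_add' y z := (P.toProjectiveResolution.add_extMk (P.cochain y.1) (P.cochain z.1) (n + 1) rfl
    (P.d_comp_cochain y.2.2) (P.d_comp_cochain z.2.2)).symm
  map_smul' r z := (P.toProjectiveResolution.extMk_comp_mk₀ (P.cochain z.1) (n + 1) rfl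
    (P.d_comp_cochain z.2.2) (rightMul r.unop)).symm

theorem mem_coboundaries_succ_iff {n : ℕ} {z : (P.X (n + 1)).carrier →ₗ[R] R}
    (hz : z ∈ totalHom (P.X (n + 1))) :
    z ∈ P.coboundaries (n + 1) ↔ ∃ g : (P.X n).carrier →ₗ[R] R, precomp (P.d n) g = z := by
  refine ⟨fun ⟨g, _, hg⟩ => ⟨g, hg⟩, fun ⟨g, hg⟩ => ?_⟩
  obtain ⟨s, hs⟩ := exists_sum_dualComponent hz
  refine ⟨∑ τ ∈ s, dualComponent (P.X n) τ g,
    sum_mem fun τ _ => homDeg_le_totalHom _ τ (dualComponent_mem _ τ g), ?_⟩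
  rw [map_sum, hs, ← hg]
  exact Finset.sum_congr rfl fun τ _ => (dualComponent_precomp (P.d_graded n) τ g).symm

theorem extClass_eq_zero_iff (n : ℕ) (z : P.cocycles n) :
    P.extClass n z = 0 ↔ z.1 ∈ P.coboundaries n := by
  cases n with
  | zero =>
    refine (extMk_zero_eq_zero_iff P.toProjectiveResolution (P.cochain z.1)
      (P.d_comp_cochain z.2.2)).trans ?_
    exact ⟨fun h => congrArg ModuleCat.Hom.hom h, fun h => ModuleCat.hom_ext h⟩
  | succ n =>
    refine (ProjectiveResolution.extMk_eq_zero_iff P.toProjectiveResolution (P.cochain z.1) _ rfl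
      (P.d_comp_cochain z.2.2) n rfl).trans ?_
    rw [P.mem_coboundaries_succ_iff z.2.1, toProjectiveResolution_d]
    exact ⟨fun ⟨g, hg⟩ => ⟨g.hom, congrArg ModuleCat.Hom.hom hg⟩,
      fun ⟨g, hg⟩ => ⟨ModuleCat.ofHom g, ModuleCat.hom_ext hg⟩⟩

theorem precomp_mem_cocycles {n : ℕ} [Module.Finite R (Q.X n).carrier]
    {φ : (P.X n).carrier →ₗ[R] (Q.X n).carrier}
    {φ' : (P.X (n + 1)).carrier →ₗ[R] (Q.X (n + 1)).carrier} (hφ : IsGrHom (P.X n) (Q.X n) φ)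
    (hφd : Q.d n ∘ₗ φ' = φ ∘ₗ P.d n) {f : (Q.X n).carrier →ₗ[R] R}
    (hf : f ∘ₗ Q.d n = 0) : precomp φ f ∈ P.cocycles n := by
  refine ⟨precomp_mem_totalHom hφ (totalHom_eq_top (Q.X n) ▸ Submodule.mem_top), ?_⟩
  change f ∘ₗ φ ∘ₗ P.d n = 0
  rw [← hφd, ← LinearMap.comp_assoc, hf, LinearMap.zero_comp]

theorem extClass_surjective {n : ℕ} (hQ : Module.Finite R (Q.X n).carrier) :
    Function.Surjective (P.extClass n) := by
  intro x
  obtain ⟨f, hf, rfl⟩ := Q.toProjectiveResolution.extMk_surjective x (n + 1) rfl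
  obtain ⟨φ, hφ, hφε, hφd⟩ := P.exists_gradedLift Q
  let Φ : ProjectiveResolution.Hom P.toProjectiveResolution Q.toProjectiveResolution (𝟙 _) :=
    { hom := ChainComplex.ofHom (fun n => ModuleCat.ofHom (φ n)) fun n => by
        rw [toProjectiveResolution_d, toProjectiveResolution_d]
        exact ModuleCat.hom_ext (hφd n)
      hom_f_zero_comp_π_f_zero := by
        rw [toProjectiveResolution_π_f_zero, toProjectiveResolution_π_f_zero]
        exact ModuleCat.hom_ext hφε }
  have hΦ := ProjectiveResolution.mk₀_comp_extMk f (n + 1) rfl hf Φ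
  have hfφ : precomp (φ n) f.hom ∈ P.cocycles n := by
    rw [toProjectiveResolution_d] at hf
    exact P.precomp_mem_cocycles Q (hφ n) (hφd n) (congrArg ModuleCat.Hom.hom hf)
  exact ⟨⟨_, hfφ⟩, hΦ.symm.trans (Abelian.Ext.mk₀_id_comp _)⟩

theorem nonempty_cohomology_equiv_ext {n : ℕ} (hQ : Module.Finite R (Q.X n).carrier) :
    Nonempty (P.cohomology n ≃ₗ[Rᵐᵒᵖ] ExtR (ModuleCat.of R M.carrier) n) := by
  have hker : (P.coboundaries n).submoduleOf (P.cocycles n) = LinearMap.ker (P.extClass n) :=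
    Submodule.ext fun z => (P.extClass_eq_zero_iff n z).symm
  exact ⟨(Submodule.quotEquivOfEq _ _ hker).trans
    ((P.extClass n).quotKerEquivOfSurjective (P.extClass_surjective Q hQ))⟩

end GrProjRes

end ExtComparison

/-! ### Finite resolutions by finitely generated projective modules -/

section FiniteResolutions

variable (R : Type v) [Ring R]

/-- `M` has a resolution of length `n` by finitely generated projective modules. -/
def HasFiniteResolution : ℕ → ∀ (M : Type v) [AddCommGroup M] [Module R M], Prop
  | 0, M, _, _ => Module.Finite R M ∧ Module.Projective R M
  | n + 1, M, _, _ => ∃ (F : Type v) (_ : AddCommGroup F) (_ : Module R F) (p : F →ₗ[R] M),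
      Module.Finite R F ∧ Module.Projective R F ∧ Function.Surjective p ∧
        HasFiniteResolution n (LinearMap.ker p)

variable {R}
variable {L F F' M M' : Type v} [AddCommGroup L] [Module R L] [AddCommGroup F] [Module R F]
  [AddCommGroup F'] [Module R F'] [AddCommGroup M] [Module R M] [AddCommGroup M'] [Module R M']

theorem HasFiniteResolution.finite {n : ℕ} (h : HasFiniteResolution R n M) :
    Module.Finite R M := by
  cases n with
  | zero => exact h.1
  | succ n =>
    obtain ⟨F, _, _, p, _, -, hp, -⟩ := h
    exact Module.Finite.of_surjective p hp

theorem HasFiniteResolution.equiv {n : ℕ} (h : HasFiniteResolution R n M) (e : M ≃ₗ[R] M') :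
    HasFiniteResolution R n M' := by
  cases n with
  | zero =>
    obtain ⟨_, _⟩ := h
    exact ⟨Module.Finite.equiv e, Module.Projective.of_equiv e⟩
  | succ n =>
    obtain ⟨F, _, _, p, hfin, hproj, hp, hK⟩ := h
    refine ⟨F, _, _, e.toLinearMap ∘ₗ p, hfin, hproj, e.surjective.comp hp, ?_⟩
    rwa [LinearEquiv.ker_comp]

theorem HasFiniteResolution.prod {n : ℕ} (h : HasFiniteResolution R n M) [Module.Finite R F]
    [Module.Projective R F] : HasFiniteResolution R n (M × F) := by
  cases n with
  | zero =>
    obtain ⟨_, _⟩ := h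
    exact ⟨inferInstance, inferInstance⟩
  | succ n =>
    obtain ⟨P, _, _, p, _, _, hp, hK⟩ := h
    refine ⟨P × F, _, _, p.prodMap LinearMap.id, inferInstance, inferInstance,
      hp.prodMap Function.surjective_id, hK.equiv ?_⟩
    rw [LinearMap.ker_prodMap, LinearMap.ker_id, ← Submodule.map_inl]
    exact Submodule.equivMapOfInjective _ LinearMap.inl_injective _

theorem nonempty_equiv_ker_prod [Module.Projective R F] {q : L →ₗ[R] F}
    (hq : Function.Surjective q) : Nonempty (L ≃ₗ[R] LinearMap.ker q × F) := by
  obtain ⟨s, hs⟩ := Module.projective_lifting_property q LinearMap.id hq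
  exact ⟨((LinearMap.exact_subtype_ker_map q).splitSurjectiveEquiv
    (LinearMap.ker q).injective_subtype ⟨s, hs⟩).1⟩

theorem HasFiniteResolution.of_prod {n : ℕ} (h : HasFiniteResolution R n (M × F))
    [Module.Finite R F] [Module.Projective R F] : HasFiniteResolution R n M := by
  cases n with
  | zero =>
    obtain ⟨_, _⟩ := h
    exact ⟨Module.Finite.of_surjective (LinearMap.fst R M F) LinearMap.fst_surjective,
      Module.Projective.of_split (LinearMap.inl R M F) (LinearMap.fst R M F)
        (LinearMap.fst_comp_inl R M F)⟩
  | succ n =>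
    obtain ⟨P, _, _, p, hfin, hproj, hp, hK⟩ := h
    let K := LinearMap.ker (LinearMap.fst R M F ∘ₗ p)
    let q : K →ₗ[R] F := LinearMap.snd R M F ∘ₗ p ∘ₗ K.subtype
    have hq : Function.Surjective q := fun y => by
      obtain ⟨x, hx⟩ := hp (0, y)
      exact ⟨⟨x, congrArg Prod.fst hx⟩, congrArg Prod.snd hx⟩
    have hle : LinearMap.ker p ≤ K := fun x hx => congrArg Prod.fst (LinearMap.mem_ker.1 hx)
    have hker : (LinearMap.ker p).submoduleOf K = LinearMap.ker q := Submodule.ext fun x =>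
      ⟨fun hx => congrArg Prod.snd hx, fun hx => Prod.ext x.2 hx⟩
    obtain ⟨e⟩ := nonempty_equiv_ker_prod hq
    have hfst : Function.Surjective (LinearMap.fst R M F) := LinearMap.fst_surjective
    refine ⟨P, _, _, LinearMap.fst R M F ∘ₗ p, hfin, hproj, hfst.comp hp, ?_⟩
    exact (HasFiniteResolution.prod (F := F) (hK.equiv
      ((Submodule.submoduleOfEquivOfLe hle).symm ≪≫ₗ LinearEquiv.ofEq _ _ hker))).equiv e.symm

/-- The isomorphism of Schanuel's lemma, for two maps to `M` that lift through each other. -/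
def schanuelEquiv {p : F →ₗ[R] M} {p' : F' →ₗ[R] M} {s : F' →ₗ[R] F} {s' : F →ₗ[R] F'}
    (hs : ∀ y, p (s y) = p' y) (hs' : ∀ x, p' (s' x) = p x) :
    (LinearMap.ker p × F') ≃ₗ[R] (LinearMap.ker p' × F) where
  toFun z := (⟨z.2 - s' (z.1 + s z.2), by simp [hs, hs']⟩, z.1 + s z.2)
  invFun z := (⟨z.2 - s (z.1 + s' z.2), by simp [hs, hs']⟩, z.1 + s' z.2)
  map_add' y z := by ext <;> simp <;> abel
  map_smul' r z := by ext <;> simp [smul_sub]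
  left_inv z := by ext <;> simp
  right_inv z := by ext <;> simp

theorem HasFiniteResolution.ker {n : ℕ} (h : HasFiniteResolution R (n + 1) M)
    [Module.Finite R F] [Module.Projective R F] {p : F →ₗ[R] M} (hp : Function.Surjective p) :
    HasFiniteResolution R n (LinearMap.ker p) := by
  obtain ⟨F', _, _, p', _, _, hp', hK⟩ := h
  obtain ⟨s, hs⟩ := Module.projective_lifting_property p p' hp
  obtain ⟨s', hs'⟩ := Module.projective_lifting_property p' p hp'
  exact (hK.prod.equiv (schanuelEquiv (LinearMap.congr_fun hs')
    (LinearMap.congr_fun hs))).of_prod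

theorem hasFiniteResolution_range {X : ℕ → Type v} [∀ n, AddCommGroup (X n)]
    [∀ n, Module R (X n)] {d : ∀ n, X (n + 1) →ₗ[R] X n}
    (hP : ∀ n, Module.Projective R (X n)) (hF : ∀ n, Module.Finite R (X n))
    (hex : ∀ n, Function.Exact (d (n + 1)) (d n)) {N : ℕ} (hN : ∀ n, N < n → Subsingleton (X n))
    (m n : ℕ) (hmn : N ≤ n + m) : HasFiniteResolution R m (LinearMap.range (d n)) := by
  induction m generalizing n with
  | zero =>
    have := hN (n + 1) (by omega)
    have : Subsingleton (LinearMap.range (d n)) := (d n).surjective_rangeRestrict.subsingleton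
    exact ⟨inferInstance, inferInstance⟩
  | succ m ih =>
    refine ⟨X (n + 1), _, _, (d n).rangeRestrict, hF _, hP _, (d n).surjective_rangeRestrict, ?_⟩
    rw [LinearMap.ker_rangeRestrict, LinearMap.exact_iff.1 (hex n)]
    exact ih (n + 1) (by omega)

end FiniteResolutions

section GradedFiniteResolutions

open CategoryTheory

theorem hasFiniteResolution_of_projectiveResolution {R : Type v} [Ring R] {M : ModuleCat.{v} R}
    (P : ProjectiveResolution M) (hF : ∀ n, Module.Finite R (P.complex.X n)) {N : ℕ}
    (hN : ∀ n, N < n → Limits.IsZero (P.complex.X n)) : HasFiniteResolution R (N + 1) M := by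
  have hP (n : ℕ) : Module.Projective R (P.complex.X n) :=
    (IsProjective.iff_projective (R := R) _).2 (P.projective n)
  refine ⟨P.complex.X 0, _, _, (P.π.f 0).hom, hF 0, hP 0,
    (ModuleCat.epi_iff_surjective (P.π.f 0)).1 inferInstance, ?_⟩
  have hker : LinearMap.ker (P.π.f 0).hom = LinearMap.range (P.complex.d 1 0).hom :=
    LinearMap.exact_iff.1
      ((ShortComplex.ShortExact.moduleCat_exact_iff_function_exact _).1 P.exact₀)
  exact (hasFiniteResolution_range (d := fun n => (P.complex.d (n + 1) n).hom) hP hF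
    (fun n => (ShortComplex.ShortExact.moduleCat_exact_iff_function_exact _).1 (P.exact_succ n))
    (fun n hn => ModuleCat.subsingleton_of_isZero (hN n hn)) N 0 (by omega)).equiv
      (LinearEquiv.ofEq _ _ hker.symm)

variable {k : Type u} [Field k] {G : Type w} [AddCommGroup G] [DecidableEq G]
variable {R : Type v} [Ring R] [Algebra k R] {𝓡 : G → Submodule k R} [GradedAlgebra 𝓡]

/-- The resolution obtained from a graded projective cover and a resolution of its kernel. -/
def GrProjRes.splice {M F : GrMod 𝓡} (hF : IsGrProjective F) (p : F.carrier →ₗ[R] M.carrier)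
    (hp : IsGrHom F M p) (hs : Function.Surjective p) (Q : GrProjRes (GrMod.ker p hp)) :
    GrProjRes M where
  X n := Nat.casesOn n F Q.X
  d n := match n with
    | 0 => (LinearMap.ker p).subtype ∘ₗ Q.ε
    | n + 1 => Q.d n
  ε := p
  d_graded n := match n with
    | 0 => Q.ε_graded
    | n + 1 => Q.d_graded n
  ε_graded := hp
  projective n := match n with
    | 0 => hF
    | n + 1 => Q.projective n
  ε_surjective := hs
  exact_zero := LinearMap.exact_iff.2 (by
    rw [LinearMap.range_comp_of_range_eq_top _ (LinearMap.range_eq_top.2 Q.ε_surjective),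
      Submodule.range_subtype])
  exact_succ
    | 0 => Q.exact_zero.comp_injective _ (LinearMap.ker p).injective_subtype (map_zero _)
    | n + 1 => Q.exact_succ n

/-- The zero graded module. -/
abbrev GrMod.zero (𝓡 : G → Submodule k R) [GradedAlgebra 𝓡] : GrMod 𝓡 :=
  GrMod.free 𝓡 PEmpty PEmpty.elim

/-- The resolution of a graded projective module by itself. -/
def GrProjRes.self {M : GrMod 𝓡} (hM : IsGrProjective M) : GrProjRes M where
  X n := Nat.casesOn n M fun _ => GrMod.zero 𝓡
  d _ := 0
  ε := LinearMap.id
  d_graded _ _ _ _ := zero_mem _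
  ε_graded := isGrHom_id M
  projective n := match n with
    | 0 => hM
    | _ + 1 => GrMod.free_isGrProjective _ _
  ε_surjective := Function.surjective_id
  exact_zero _ := ⟨fun h => ⟨0, h.symm⟩, fun ⟨_, h⟩ => h.symm⟩
  exact_succ _ _ := ⟨fun _ => ⟨0, Subsingleton.elim (α := Π₀ _ : PEmpty, R) _ _⟩, fun _ => rfl⟩

theorem exists_finite_grProjRes {n : ℕ} {M : GrMod 𝓡} (h : HasFiniteResolution R n M.carrier) :
    ∃ P : GrProjRes M, (∀ n, Module.Finite R (P.X n).carrier) ∧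
      ∃ N : ℕ, ∀ n, N < n → Subsingleton (P.X n).carrier := by
  induction n generalizing M with
  | zero =>
    obtain ⟨hfin, _⟩ := h
    refine ⟨GrProjRes.self (isGrProjective_of_projective M), fun n => ?_, 0, fun n hn => ?_⟩
    · cases n with
      | zero => exact hfin
      | succ n => exact inferInstanceAs (Module.Finite R (Π₀ _ : PEmpty, R))
    · cases n with
      | zero => omega
      | succ n => exact inferInstanceAs (Subsingleton (Π₀ _ : PEmpty, R))
  | succ n ih =>
    have := h.finite
    obtain ⟨F, p, hF, hfin, hp, hs⟩ := M.exists_finite_cover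
    have := hF.projective
    obtain ⟨Q, hQ, N, hN⟩ := ih (M := GrMod.ker p hp) (h.ker hs)
    refine ⟨GrProjRes.splice hF p hp hs Q, fun n => ?_, N + 1, fun n hn => ?_⟩
    · cases n with
      | zero => exact hfin
      | succ n => exact hQ n
    · cases n with
      | zero => omega
      | succ n => exact hN n (by omega)

end GradedFiniteResolutions

section HomologicalSmoothness

variable {k : Type u} [Field k] {A : Type v} [Ring A] [Algebra k A]
variable {G : Type w} [AddCommGroup G] [DecidableEq G] (𝒜 : G → Submodule k A) [GradedAlgebra 𝒜]

theorem isHomologicallySmooth_iff : IsHomologicallySmooth k A ↔ IsGrHomologicallySmooth 𝒜 := by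
  refine ⟨fun ⟨P, hF, N, hN⟩ => exists_finite_grProjRes (M := grSelf 𝒜)
    (hasFiniteResolution_of_projectiveResolution P hF hN), fun ⟨P, hF, N, hN⟩ =>
    ⟨P.toProjectiveResolution, hF, N, fun n hn => ?_⟩⟩
  have := hN n hn
  exact ModuleCat.isZero_of_subsingleton (ModuleCat.of (Env k A) (P.X n).carrier)

end HomologicalSmoothness

/-! ### Invertible bimodules and Morita contexts -/

section Morita

open MulOpposite

open scoped ModuleCat.Algebra

variable {k : Type u} [Field k] {A : Type v} [Ring A] [Algebra k A]

/-- A map that respects the actions of pure tensors is linear over the enveloping algebra. -/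
def envLinearMap {M N : Type*} [AddCommGroup M] [Module (Env k A) M] [AddCommGroup N]
    [Module (Env k A) N] (f : M →+ N)
    (hf : ∀ a b m, f ((a ⊗ₜ op b : Env k A) • m) = (a ⊗ₜ op b : Env k A) • f m) :
    M →ₗ[Env k A] N where
  __ := f
  map_smul' r m := by
    change f (r • m) = r • f m
    induction r using TensorProduct.induction_on with
    | zero =>
      calc f ((0 : Env k A) • m) = f 0 := congrArg f (zero_smul (Env k A) m)
        _ = (0 : Env k A) • f m := (map_zero f).trans (zero_smul (Env k A) (f m)).symm
    | tmul a b => exact hf a b.unop m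
    | add x y hx hy => rw [add_smul, map_add, hx, hy, add_smul]

/-- The left action of the algebra on a bimodule. -/
def lmul (U : ModuleCat.{v} (Env k A)) : A →ₐ[k] Module.End k U :=
  (act U).comp Algebra.TensorProduct.includeLeft

/-- The right action of the algebra on a bimodule. -/
def rmul (U : ModuleCat.{v} (Env k A)) : Aᵐᵒᵖ →ₐ[k] Module.End k U :=
  (act U).comp Algebra.TensorProduct.includeRight

variable {U V : ModuleCat.{v} (Env k A)}

theorem lmul_mul (a b : A) (u : U) : lmul U (a * b) u = lmul U a (lmul U b u) := by
  rw [map_mul, Module.End.mul_apply]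

theorem rmul_mul (a b : A) (u : U) : rmul U (op (a * b)) u = rmul U (op b) (rmul U (op a) u) := by
  rw [op_mul, map_mul, Module.End.mul_apply]

theorem tmul_smul_eq (a : A) (b : Aᵐᵒᵖ) (u : U) :
    (a ⊗ₜ b : Env k A) • u = lmul U a (rmul U b u) := by
  change _ = (a ⊗ₜ 1 : Env k A) • (1 ⊗ₜ b : Env k A) • u
  rw [smul_smul, Algebra.TensorProduct.tmul_mul_tmul, mul_one, one_mul]

theorem rmul_lmul (a : A) (b : Aᵐᵒᵖ) (u : U) :
    rmul U b (lmul U a u) = lmul U a (rmul U b u) := by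
  rw [← tmul_smul_eq]
  change (1 ⊗ₜ b : Env k A) • (a ⊗ₜ 1 : Env k A) • u = _
  rw [smul_smul, Algebra.TensorProduct.tmul_mul_tmul, mul_one, one_mul]

theorem tmul_smul_tmulA (a b : A) (u : U) (v : V) :
    (a ⊗ₜ op b : Env k A) • tmulA u v = tmulA (lmul U a u) (rmul V (op b) v) :=
  env_smul_tmulA a b u v

theorem tmulA_balanced (u : U) (a : A) (v : V) :
    tmulA (rmul U (op a) u) v = tmulA u (lmul V a v) :=
  (Submodule.Quotient.eq (tensorRel U V)).2 (Submodule.subset_span ⟨u, a, v, rfl⟩)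

theorem algebraMap_smul_tensorA (c : k) (x : tensorA U V) :
    algebraMap k (Env k A) c • x = c • x := by
  change tensorAct U V (algebraMap k (Env k A) c) x = _
  rw [AlgHom.commutes]
  rfl

theorem algebraMap_env_smul (c : k) (a : A) : algebraMap k (Env k A) c • a = c • a := by
  rw [Algebra.TensorProduct.algebraMap_apply, ← op_one, env_smul, mul_one, Algebra.smul_def]

/-- The universal balanced bilinear map. -/
def tmulBilin : U →ₗ[k] V →ₗ[k] tensorA U V :=
  LinearMap.mk₂ k tmulA tmulA_add_left tmulA_smul_left tmulA_add_right tmulA_smul_right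

theorem tmulA_sum_sum {ι κ : Type*} (s : Finset ι) (t : Finset κ) (f : ι → U) (g : κ → V) :
    tmulA (∑ i ∈ s, f i) (∑ j ∈ t, g j) = ∑ i ∈ s, ∑ j ∈ t, tmulA (f i) (g j) :=
  (LinearMap.map_sum₂ tmulBilin s f _).trans
    (Finset.sum_congr rfl fun i _ => map_sum (tmulBilin (f i)) g t)

@[elab_as_elim]
theorem tensorA_induction {p : tensorA U V → Prop} (x : tensorA U V)
    (tmul : ∀ u v, p (tmulA u v)) (add : ∀ x y, p x → p y → p (x + y)) : p x := by
  obtain ⟨t, rfl⟩ := Submodule.mkQ_surjective (tensorRel U V) x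
  induction t using TensorProduct.induction_on with
  | zero =>
    rw [← TensorProduct.zero_tmul U (0 : V)]
    exact tmul 0 0
  | tmul u v => exact tmul u v
  | add x y hx hy =>
    rw [map_add]
    exact add _ _ hx hy

/-- The linear map out of `U ⊗_A V` defined by a balanced bilinear map. -/
def tensorLift {W : Type*} [AddCommGroup W] [Module k W] (f : U →ₗ[k] V →ₗ[k] W)
    (hf : ∀ u a v, f (rmul U (op a) u) v = f u (lmul V a v)) : tensorA U V →ₗ[k] W :=
  (tensorRel U V).liftQ (TensorProduct.lift f) (by
    refine Submodule.span_le.2 ?_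
    rintro _ ⟨u, a, v, rfl⟩
    rw [SetLike.mem_coe, LinearMap.mem_ker, map_sub, TensorProduct.lift.tmul,
      TensorProduct.lift.tmul, sub_eq_zero]
    exact hf u a v)

theorem tensorLift_tmulA {W : Type*} [AddCommGroup W] [Module k W] (f : U →ₗ[k] V →ₗ[k] W)
    (hf : ∀ u a v, f (rmul U (op a) u) v = f u (lmul V a v)) (u : U) (v : V) :
    tensorLift f hf (tmulA u v) = f u v :=
  rfl

section CongrLeft

variable {U' : ModuleCat.{v} (Env k A)}

/-- The map `f ⊗_A V` of bimodules. -/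
def tensorMapLeft (V : ModuleCat.{v} (Env k A)) (f : U →ₗ[Env k A] U') :
    tensorA U V →ₗ[Env k A] tensorA U' V :=
  let g : tensorA U V →ₗ[k] tensorA U' V :=
    tensorLift (tmulBilin ∘ₗ f.restrictScalars k) fun u a v =>
      (congrArg (tmulA · v) (map_smul f _ u)).trans (tmulA_balanced (f u) a v)
  envLinearMap g.toAddMonoidHom fun a b x => by
    change g ((a ⊗ₜ op b : Env k A) • x) = (a ⊗ₜ op b : Env k A) • g x
    refine tensorA_induction x (fun u v => ?_) (fun x y hx hy => ?_)
    · rw [tmul_smul_tmulA]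
      exact (congrArg (tmulA · _) (map_smul f _ u)).trans (tmul_smul_tmulA a b (f u) v).symm
    · rw [smul_add, map_add, hx, hy, map_add, smul_add]

/-- The isomorphism `f ⊗_A V` of bimodules. -/
def tensorCongrLeft (V : ModuleCat.{v} (Env k A)) (f : U ≃ₗ[Env k A] U') :
    tensorA U V ≃ₗ[Env k A] tensorA U' V :=
  .ofLinearMap (tensorMapLeft V f.toLinearMap) (tensorMapLeft V f.symm.toLinearMap)
    (LinearMap.ext fun x => tensorA_induction x
      (fun u v => congrArg (tmulA · v) (f.apply_symm_apply u))
      (fun x y hx hy => by rw [map_add, hx, hy, map_add]))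
    (LinearMap.ext fun x => tensorA_induction x
      (fun u v => congrArg (tmulA · v) (f.symm_apply_apply u))
      (fun x y hx hy => by rw [map_add, hx, hy, map_add]))

end CongrLeft

/-- The pairing defined by an isomorphism `U ⊗_A V ≃ A`. -/
def pair (e : tensorA U V ≃ₗ[Env k A] A) : U →ₗ[k] V →ₗ[k] A :=
  LinearMap.compr₂ tmulBilin
    { e with
      map_smul' := fun c x => by
        change e (c • x) = c • e x
        rw [← algebraMap_smul_tensorA, map_smul, algebraMap_env_smul] }

section Pair

variable (e : tensorA U V ≃ₗ[Env k A] A)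

theorem pair_apply (u : U) (v : V) : pair e u v = e (tmulA u v) := rfl

theorem pair_lmul (a : A) (u : U) (v : V) : pair e (lmul U a u) v = a * pair e u v := by
  have h := tmul_smul_tmulA a 1 u v
  rw [op_one, map_one, Module.End.one_apply] at h
  rw [pair_apply, ← h, map_smul, ← op_one, env_smul, mul_one, pair_apply]

theorem pair_rmul (u : U) (v : V) (b : A) : pair e u (rmul V (op b) v) = pair e u v * b := by
  have h := tmul_smul_tmulA 1 b u v
  rw [map_one, Module.End.one_apply] at h
  rw [pair_apply, ← h, map_smul, env_smul, one_mul, pair_apply]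

theorem pair_balanced (u : U) (a : A) (v : V) :
    pair e (rmul U (op a) u) v = pair e u (lmul V a v) := by
  rw [pair_apply, tmulA_balanced, pair_apply]

theorem pair_tmul_smul (a b : A) (u : U) (v : V) :
    pair e u ((a ⊗ₜ op b : Env k A) • v) = pair e (rmul U (op a) u) v * b := by
  rw [tmul_smul_eq, ← rmul_lmul, pair_rmul, pair_balanced]

theorem exists_sum_pair_eq_one : ∃ s : Finset (U × V), ∑ p ∈ s, pair e p.1 p.2 = 1 := by
  obtain ⟨t, ht⟩ := Submodule.mkQ_surjective (tensorRel U V) (e.symm 1)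
  obtain ⟨s, rfl⟩ := TensorProduct.exists_finset t
  refine ⟨s, ?_⟩
  rw [← e.apply_symm_apply 1, ← ht, map_sum]
  exact (map_sum e _ _).symm

theorem rmul_ext_of_pair {W : ModuleCat.{v} (Env k A)} {w w' : W}
    (h : ∀ u v, rmul W (op (pair e u v)) w = rmul W (op (pair e u v)) w') : w = w' := by
  obtain ⟨s, hs⟩ := exists_sum_pair_eq_one e
  have hsum (x : W) : ∑ p ∈ s, rmul W (op (pair e p.1 p.2)) x = x := by
    rw [← LinearMap.sum_apply, ← map_sum, ← Finset.op_sum, hs, op_one, map_one,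
      Module.End.one_apply]
  rw [← hsum w, ← hsum w']
  exact Finset.sum_congr rfl fun p _ => h p.1 p.2

end Pair

theorem eq_of_rmul_eq (e : tensorA U V ≃ₗ[Env k A] A) {a b : A}
    (h : ∀ v : V, rmul V (op a) v = rmul V (op b) v) : a = b := by
  obtain ⟨s, hs⟩ := exists_sum_pair_eq_one e
  rw [← one_mul a, ← one_mul b, ← hs, Finset.sum_mul, Finset.sum_mul]
  exact Finset.sum_congr rfl fun p _ => by rw [← pair_rmul, h, pair_rmul]

variable (e : tensorA U V ≃ₗ[Env k A] A) (e' : tensorA V U ≃ₗ[Env k A] A)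

theorem rmul_pair_eq_zero {u : U} {v : V} (h : pair e u v = 0) (u' : U) :
    rmul U (op (pair e' v u')) u = 0 := by
  let f : U →ₗ[k] V →ₗ[k] U :=
    ((rmul U).toLinearMap ∘ₗ (opLinearEquiv k).toLinearMap ∘ₗ (pair e').flip u').flip
  have hf (u a v) : f (rmul U (op a) u) v = f u (lmul V a v) := by
    change rmul U (op (pair e' v u')) (rmul U (op a) u) = rmul U (op (pair e' (lmul V a v) u')) u
    rw [pair_lmul, rmul_mul]
  have htmul : tmulA u v = 0 := (map_eq_zero_iff e e.injective).1 h
  calc rmul U (op (pair e' v u')) u = tensorLift f hf (tmulA u v) := rfl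
    _ = 0 := by rw [htmul, map_zero]

theorem exists_lmul_pair_eq_rmul (u : U) :
    ∃ c : U, ∀ v u', lmul U (pair e u v) u' = rmul U (op (pair e' v u')) c := by
  let g : tensorA V U →ₗ[k] U := tensorLift ((lmul U).toLinearMap ∘ₗ pair e u) fun v a u' => by
    change lmul U (pair e u (rmul V (op a) v)) u' = lmul U (pair e u v) (lmul U a u')
    rw [pair_rmul, lmul_mul]
  have hg (v u') : g (tmulA v u') = lmul U (pair e u v) u' := tensorLift_tmulA _ _ v u'
  have hlin (x) (a : A) : g ((1 ⊗ₜ op a : Env k A) • x) = rmul U (op a) (g x) := by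
    refine tensorA_induction x (fun v u' => ?_) (fun x y hx hy => ?_)
    · rw [tmul_smul_tmulA, map_one, Module.End.one_apply, hg, hg, rmul_lmul]
    · rw [smul_add, map_add, hx, hy, map_add, map_add]
  refine ⟨g (e'.symm 1), fun v u' => ?_⟩
  rw [← hlin, ← hg, ← map_smul, env_smul, one_mul, one_mul, pair_apply, e'.symm_apply_apply]

theorem exists_linearMap_lmul_pair_eq_rmul :
    ∃ θ : U →ₗ[Env k A] U, ∀ u v u',
      lmul U (pair e u v) u' = rmul U (op (pair e' v u')) (θ u) := by
  choose θ hθ using exists_lmul_pair_eq_rmul e e'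
  refine ⟨envLinearMap (AddMonoidHom.mk' θ fun x y => rmul_ext_of_pair e' fun v u' => ?_)
    fun a b u => rmul_ext_of_pair e' fun v u' => ?_, hθ⟩
  · rw [map_add, ← hθ, ← hθ, ← hθ, map_add, LinearMap.add_apply, map_add, LinearMap.add_apply]
  · change rmul U _ (θ ((a ⊗ₜ op b : Env k A) • u)) = rmul U _ ((a ⊗ₜ op b : Env k A) • θ u)
    rw [tmul_smul_eq, tmul_smul_eq, ← hθ, pair_lmul, pair_balanced, lmul_mul,
      hθ, pair_lmul, rmul_mul, rmul_lmul]

theorem exists_linearEquiv_lmul_pair_eq_rmul :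
    ∃ θ : U ≃ₗ[Env k A] U, ∀ u v u',
      lmul U (pair e u v) u' = rmul U (op (pair e' v u')) (θ u) := by
  obtain ⟨θ, hθ⟩ := exists_linearMap_lmul_pair_eq_rmul e e'
  obtain ⟨s, hs⟩ := exists_sum_pair_eq_one e
  refine ⟨LinearEquiv.ofBijective θ ⟨?_, fun u' => ?_⟩, hθ⟩
  · refine (injective_iff_map_eq_zero θ).2 fun u hu => rmul_ext_of_pair e' fun v u' => ?_
    have hlmul (w : U) : lmul U (pair e u v) w = 0 := by rw [hθ, hu, map_zero]
    have hpair : pair e u v = 0 := by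
      rw [← mul_one (pair e u v), ← hs, Finset.mul_sum]
      refine Finset.sum_eq_zero fun p _ => ?_
      rw [← pair_lmul, hlmul, map_zero, LinearMap.zero_apply]
    rw [rmul_pair_eq_zero e e' hpair, map_zero]
  · refine ⟨∑ p ∈ s, rmul U (op (pair e' p.2 u')) p.1, ?_⟩
    calc θ (∑ p ∈ s, rmul U (op (pair e' p.2 u')) p.1)
        = ∑ p ∈ s, rmul U (op (pair e' p.2 u')) (θ p.1) := by
          rw [map_sum]
          exact Finset.sum_congr rfl fun p _ => map_smul θ _ p.1
      _ = ∑ p ∈ s, lmul U (pair e p.1 p.2) u' :=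
          Finset.sum_congr rfl fun p _ => (hθ p.1 p.2 u').symm
      _ = u' := by
          rw [← LinearMap.sum_apply, ← map_sum, hs, map_one, Module.End.one_apply]

/-- The associativity condition of a Morita context: the two ways of contracting
`U ⊗_A V ⊗_A U` to `U` agree. -/
def IsCompatible : Prop :=
  ∀ u v u', lmul U (pair e u v) u' = rmul U (op (pair e' v u')) u

theorem IsInvertible.exists_isCompatible (h : IsInvertible U) :
    ∃ (V : ModuleCat.{v} (Env k A)) (e : tensorA U V ≃ₗ[Env k A] A)
      (e' : tensorA V U ≃ₗ[Env k A] A), IsCompatible e e' := by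
  -- The two contractions of `U ⊗ V ⊗ U` differ by an automorphism of `U`, which is absorbed into
  -- the first pairing.
  obtain ⟨V, ⟨e⟩, ⟨e'⟩⟩ := h
  obtain ⟨θ, hθ⟩ := exists_linearEquiv_lmul_pair_eq_rmul e e'
  refine ⟨V, (tensorCongrLeft V θ.symm).trans e, e', fun u v u' => ?_⟩
  exact (hθ (θ.symm u) v u').trans (congrArg _ (θ.apply_symm_apply u))

variable {e e'}

theorem IsCompatible.sum_lmul_pair (hc : IsCompatible e e') {s : Finset (V × U)}
    (hs : ∑ p ∈ s, pair e' p.1 p.2 = 1) (u : U) : ∑ p ∈ s, lmul U (pair e u p.1) p.2 = u := by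
  rw [Finset.sum_congr rfl fun p _ => hc u p.1 p.2, ← LinearMap.sum_apply, ← map_sum,
    ← Finset.op_sum, hs, op_one, map_one, Module.End.one_apply]

end Morita

/-! ### Graded invertible bimodules -/

section GradedInvertible

open MulOpposite

open scoped ModuleCat.Algebra

theorem isInternal_comap {ι M N : Type*} [DecidableEq ι] [AddCommGroup M] [AddCommGroup N]
    {deg : ι → AddSubgroup N} (h : DirectSum.IsInternal deg) (f : M →+ N)
    (hf : Function.Bijective f) : DirectSum.IsInternal fun i => (deg i).comap f := by
  let g : (⨁ i, (deg i).comap f) →+ ⨁ i, deg i :=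
    DirectSum.map fun i => f.addSubgroupComap (deg i)
  have hg : Function.Bijective g :=
    ⟨(DirectSum.map_injective _).2 fun i x y hxy =>
      Subtype.ext (hf.injective (congrArg Subtype.val hxy)),
      (DirectSum.map_surjective _).2 fun i =>
        f.addSubgroupComap_surjective_of_surjective (deg i) hf.surjective⟩
  have hcomm : f.comp (DirectSum.coeAddMonoidHom fun i => (deg i).comap f) =
      (DirectSum.coeAddMonoidHom deg).comp g := by
    ext i x
    simp only [AddMonoidHom.coe_comp, Function.comp_apply, DirectSum.coeAddMonoidHom_of,
      DirectSum.map_of, g]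
    rfl
  refine (Function.Bijective.of_comp_iff' hf _).1 ?_
  rw [← AddMonoidHom.coe_comp, hcomm]
  exact h.comp hg

variable {k : Type u} [Field k] {A : Type v} [Ring A] [Algebra k A]
variable {G : Type w} [AddCommGroup G]
variable {𝒜 : G → Submodule k A}

theorem env_smul_mem {M : Type*} [AddCommGroup M] [Module (Env k A) M] {deg : G → AddSubgroup M}
    (h : ∀ {i j l : G} {a b : A} {m : M}, a ∈ 𝒜 i → b ∈ 𝒜 j → m ∈ deg l →
      (a ⊗ₜ op b : Env k A) • m ∈ deg (i + j + l))
    {γ l : G} {r : Env k A} {m : M} (hr : r ∈ envGrading 𝒜 γ) (hm : m ∈ deg l) :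
    r • m ∈ deg (γ + l) := by
  have hscalar : ∀ c : k, (c • r) • m ∈ deg (γ + l) := by
    induction hr using Submodule.span_induction with
    | mem r hr =>
      obtain ⟨i, j, a, b, rfl, ha, hb, rfl⟩ := hr
      intro c
      rw [TensorProduct.smul_tmul']
      exact h ((𝒜 i).smul_mem c ha) hb hm
    | zero =>
      intro c
      rw [smul_zero]
      exact (zero_smul (Env k A) m).symm ▸ zero_mem _
    | add x y _ _ hx hy =>
      intro c
      rw [smul_add, add_smul]
      exact add_mem (hx c) (hy c)
    | smul c' x _ hx =>
      intro c
      rw [smul_smul]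
      exact hx _
  exact one_smul k r ▸ hscalar 1

variable [DecidableEq G]

theorem iSup_tensorDeg (U V : GrMod (envGrading 𝒜)) : ⨆ γ, tensorDeg U V γ = ⊤ := by
  refine (AddSubgroup.eq_top_iff' _).2 fun x => ?_
  refine tensorA_induction x (fun u v => ?_) fun x y hx hy => add_mem hx hy
  obtain ⟨s, hs⟩ := U.exists_sum_proj u
  obtain ⟨t, ht⟩ := V.exists_sum_proj v
  rw [hs, ht]
  refine (tmulA_sum_sum (U := U.forget) (V := V.forget) s t _ _).symm ▸
    sum_mem fun i _ => sum_mem fun j _ => AddSubgroup.mem_iSup_of_mem (i + j) ?_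
  exact AddSubgroup.subset_closure
    ⟨i, j, U.proj i u, V.proj j v, rfl, U.proj_mem i u, V.proj_mem j v, rfl⟩

theorem GrMod.mem_iff_of_injective (N : GrMod 𝒜) {M : Type*} [AddCommGroup M]
    {deg : G → AddSubgroup M} (htop : ⨆ i, deg i = ⊤) {f : M →+ N.carrier}
    (hf : Function.Injective f) (hdeg : ∀ i, ∀ x ∈ deg i, f x ∈ N.deg i) (i : G) (x : M) :
    x ∈ deg i ↔ f x ∈ N.deg i := by
  refine ⟨hdeg i x, fun hx => ?_⟩
  have hlift (z : M) : ∃ y ∈ deg i, f y = N.proj i (f z) := by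
    refine AddSubgroup.iSup_induction deg (C := fun z => ∃ y ∈ deg i, f y = N.proj i (f z))
      (htop ▸ AddSubgroup.mem_top z) (fun j z hz => ?_)
      ⟨0, zero_mem _, by rw [map_zero, map_zero]⟩ ?_
    · obtain rfl | hj := eq_or_ne j i
      · exact ⟨z, hz, (N.proj_same j _ (hdeg j z hz)).symm⟩
      · exact ⟨0, zero_mem _, by rw [map_zero, N.proj_ne i j hj _ (hdeg j z hz)]⟩
    · rintro z z' ⟨y, hy, hyz⟩ ⟨y', hy', hyz'⟩
      exact ⟨y + y', add_mem hy hy', by rw [map_add, hyz, hyz', map_add, map_add]⟩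
  obtain ⟨y, hy, hyx⟩ := hlift x
  rw [N.proj_same i _ hx] at hyx
  exact hf hyx ▸ hy

variable [GradedAlgebra 𝒜]

theorem lmul_mem (U : GrMod (envGrading 𝒜)) {i j : G} {a : A} (ha : a ∈ 𝒜 i) {u : U.carrier}
    (hu : u ∈ U.deg j) : lmul U.forget a u ∈ U.deg (i + j) :=
  U.smul_mem (Submodule.subset_span
    ⟨i, 0, a, 1, add_zero i, ha, SetLike.GradedOne.one_mem, rfl⟩) hu

theorem rmul_mem (U : GrMod (envGrading 𝒜)) {i j : G} {a : A} (ha : a ∈ 𝒜 i) {u : U.carrier}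
    (hu : u ∈ U.deg j) : rmul U.forget (op a) u ∈ U.deg (j + i) := by
  rw [add_comm]
  exact U.smul_mem (Submodule.subset_span
    ⟨0, i, 1, a, zero_add i, SetLike.GradedOne.one_mem, ha, rfl⟩) hu

theorem rmul_proj (U : GrMod (envGrading 𝒜)) {j : G} {u : U.carrier} (hu : u ∈ U.deg j) (i : G)
    (a : A) : rmul U.forget (op ((GrMod.regular 𝒜).proj i a)) u =
      U.proj (j + i) (rmul U.forget (op a) u) := by
  refine (GrMod.regular 𝒜).homogeneous_induction a (fun i' a ha => ?_) ?_ fun x y hx hy => ?_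
  · have hau := rmul_mem U ha hu
    obtain rfl | hi := eq_or_ne i' i
    · rw [(GrMod.regular 𝒜).proj_same i' a ha]
      exact (U.proj_same _ _ hau).symm
    · rw [(GrMod.regular 𝒜).proj_ne i i' hi a ha, op_zero, map_zero]
      exact (U.proj_ne _ _ (by simpa using hi) _ hau).symm
  · rw [map_zero, op_zero, map_zero]
    exact (map_zero _).symm
  · rw [map_add, op_add, op_add, map_add, map_add]
    exact (congrArg₂ _ hx hy).trans (map_add _ _ _).symm

/-- The graded left module underlying a graded bimodule. -/
def GrMod.leftModule (U : GrMod (envGrading 𝒜)) : GrMod 𝒜 :=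
  letI := Module.compHom U.carrier
    (Algebra.TensorProduct.includeLeft (R := k) (S := k) (A := A) (B := Aᵐᵒᵖ)).toRingHom
  { carrier := U.carrier
    deg := U.deg
    isInternal := U.isInternal
    smul_mem := fun hr hm => lmul_mem U hr hm }

section Inverse

variable {U : GrMod (envGrading 𝒜)} {V : ModuleCat.{v} (Env k A)}

/-- The map `V → Hom_A(U, A)` adjoint to the pairing of `U` and `V`. -/
def pairHom (e : tensorA U.forget V ≃ₗ[Env k A] A) : V →+ (U.leftModule.carrier →ₗ[A] A) :=
  AddMonoidHom.mk'
    (fun v =>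
      { toFun := fun u => pair (U := U.forget) e u v
        map_add' := fun x y => LinearMap.congr_fun (map_add (pair (U := U.forget) e) x y) v
        map_smul' := fun a x => pair_lmul (U := U.forget) e a x v })
    fun v v' => LinearMap.ext fun u => map_add (pair (U := U.forget) e u) v v'

theorem pairHom_injective (e : tensorA U.forget V ≃ₗ[Env k A] A)
    (e' : tensorA V U.forget ≃ₗ[Env k A] A) : Function.Injective (pairHom e) := by
  refine (injective_iff_map_eq_zero _).2 fun v hv => ?_
  have hpair (u : U.forget) : pair e u v = 0 := LinearMap.congr_fun hv u
  obtain ⟨s, hs⟩ := exists_sum_pair_eq_one e'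
  calc v = ∑ p ∈ s, lmul V (pair e' p.1 p.2) v := by
        rw [← LinearMap.sum_apply, ← map_sum, hs, map_one, Module.End.one_apply]
    _ = 0 := Finset.sum_eq_zero fun p _ => by
        obtain ⟨c, hc⟩ := exists_lmul_pair_eq_rmul e' e p.1
        rw [hc, hpair, op_zero, map_zero, LinearMap.zero_apply]

/-- The grading of the inverse of a graded bimodule, transported from `Hom_A(U, A)`. -/
def pairDeg (e : tensorA U.forget V ≃ₗ[Env k A] A) (τ : G) : AddSubgroup V :=
  (homDeg U.leftModule τ).comap (pairHom e)

theorem pair_mem {e : tensorA U.forget V ≃ₗ[Env k A] A} {σ τ : G} {u : U.forget} {v : V}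
    (hu : u ∈ U.deg σ) (hv : v ∈ pairDeg e τ) : pair e u v ∈ 𝒜 (σ + τ) :=
  hv σ u hu

variable {e : tensorA U.forget V ≃ₗ[Env k A] A} {e' : tensorA V U.forget ≃ₗ[Env k A] A}

theorem IsCompatible.finite_leftModule (hc : IsCompatible (U := U.forget) e e') :
    Module.Finite A U.leftModule.carrier := by
  classical
  obtain ⟨s, hs⟩ := exists_sum_pair_eq_one e'
  refine ⟨⟨s.image Prod.snd, (Submodule.eq_top_iff').2 fun u => ?_⟩⟩
  have hu : ∑ p ∈ s, lmul U.forget (pair e u p.1) p.2 = u := hc.sum_lmul_pair hs u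
  rw [← hu]
  exact sum_mem fun p hp => Submodule.smul_mem _ (pair e (U := U.forget) u p.1)
    (Submodule.subset_span (Finset.mem_coe.2 (Finset.mem_image_of_mem _ hp)))

theorem IsCompatible.pairHom_surjective (hc : IsCompatible (U := U.forget) e e') :
    Function.Surjective (pairHom e) := by
  intro f
  obtain ⟨s, hs⟩ := exists_sum_pair_eq_one e'
  refine ⟨∑ p ∈ s, rmul V (op (f p.2)) p.1, LinearMap.ext fun (u : U.forget) => ?_⟩
  calc pair e u (∑ p ∈ s, rmul V (op (f p.2)) p.1)
      = ∑ p ∈ s, pair e u p.1 * f p.2 := by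
        rw [map_sum]
        exact Finset.sum_congr rfl fun p _ => pair_rmul e u p.1 (f p.2)
    _ = ∑ p ∈ s, f (lmul U.forget (pair e u p.1) p.2) :=
        Finset.sum_congr rfl fun p _ => (f.map_smul (pair e u p.1) p.2).symm
    _ = f u := by
        refine (map_sum f _ _).symm.trans ?_
        exact congrArg f (hc.sum_lmul_pair hs u)

theorem IsCompatible.pair_symm_mem (hc : IsCompatible (U := U.forget) e e') {τ ρ : G}
    {v : V} (hv : v ∈ pairDeg e τ) {u : U.forget} (hu : u ∈ U.deg ρ) : pair e' v u ∈ 𝒜 (τ + ρ) := by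
  have hproj : (GrMod.regular 𝒜).proj (τ + ρ) (pair e' v u) = pair e' v u := by
    refine eq_of_rmul_eq e' fun w => ?_
    refine U.homogeneous_induction w (fun ι w hw => ?_) ?_ fun x y hx hy => ?_
    · have hmem : rmul U.forget (op (pair e' v u)) w ∈ U.deg (ι + (τ + ρ)) := by
        rw [← hc w v u, ← add_assoc]
        exact lmul_mem U (pair_mem hw hv) hu
      exact (rmul_proj U hw _ _).trans (U.proj_same _ _ hmem)
    · exact (map_zero _).trans (map_zero _).symm
    · exact (map_add _ _ _).trans ((congrArg₂ _ hx hy).trans (map_add _ _ _).symm)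
  rw [← hproj]
  exact (GrMod.regular 𝒜).proj_mem _ _

/-- The inverse of an invertible graded bimodule, as a graded bimodule. -/
def inverseGrMod (hc : IsCompatible (U := U.forget) e e') : GrMod (envGrading 𝒜) where
  carrier := V
  deg := pairDeg e
  isInternal :=
    have := hc.finite_leftModule
    isInternal_comap (homDeg_isInternal U.leftModule) (pairHom e)
      ⟨pairHom_injective e e', hc.pairHom_surjective⟩
  smul_mem := env_smul_mem fun {i j l a b v} ha hb hv ρ (u : U.forget) hu => by
    change pair e u ((a ⊗ₜ op b : Env k A) • v) ∈ 𝒜 (ρ + (i + j + l))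
    rw [pair_tmul_smul, show ρ + (i + j + l) = ρ + i + l + j by abel]
    exact SetLike.GradedMul.mul_mem (pair_mem (rmul_mem U ha hu) hv) hb

end Inverse

theorem mem_tensorDeg_iff {U V : GrMod (envGrading 𝒜)}
    (e : tensorA U.forget V.forget ≃ₗ[Env k A] A)
    (he : ∀ i j, ∀ u ∈ U.deg i, ∀ v ∈ V.deg j,
      pair e (U := U.forget) (V := V.forget) u v ∈ 𝒜 (i + j)) (γ : G)
    (x : tensorA U.forget V.forget) : x ∈ tensorDeg U V γ ↔ e x ∈ 𝒜 γ := by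
  refine (GrMod.regular 𝒜).mem_iff_of_injective (iSup_tensorDeg U V)
    (f := e.toAddEquiv.toAddMonoidHom) e.injective (fun γ x hx => ?_) γ x
  refine (AddSubgroup.closure_le ((𝒜 γ).toAddSubgroup.comap e.toAddEquiv.toAddMonoidHom)).2 ?_ hx
  rintro _ ⟨i, j, u, v, rfl, hu, hv, rfl⟩
  exact he i j u hu v hv

theorem isGrInvertible_of_isInvertible (U : GrMod (envGrading 𝒜)) (h : IsInvertible U.forget) :
    IsGrInvertible U := by
  obtain ⟨V, e, e', hc⟩ := h.exists_isCompatible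
  exact ⟨inverseGrMod hc,
    ⟨e, mem_tensorDeg_iff (V := inverseGrMod hc) e fun _ _ _ hu _ hv => pair_mem hu hv⟩,
    ⟨e', mem_tensorDeg_iff (U := inverseGrMod hc) e' fun _ _ _ hv _ hu => hc.pair_symm_mem hv hu⟩⟩

end GradedInvertible

/-! ### Comparison of graded and ungraded twisted Calabi–Yau algebras -/

section Main

open MulOpposite CategoryTheory

variable {k : Type u} [Field k] {A : Type v} [Ring A] [Algebra k A]
variable {G : Type w} [AddCommGroup G] [DecidableEq G]
variable {𝒜 : G → Submodule k A} [GradedAlgebra 𝒜]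

theorem IsGrHomologicallySmooth.nonempty_grExt_equiv (h : IsGrHomologicallySmooth 𝒜) (n : ℕ) :
    Nonempty (grExt (grSelf 𝒜) n ≃ₗ[(Env k A)ᵐᵒᵖ] ExtR (ModuleCat.of (Env k A) A) n) := by
  obtain ⟨P, hP, -⟩ := h
  exact (Classical.choice (GrProjRes.exists (grSelf 𝒜))).nonempty_cohomology_equiv_ext P (hP n)

/-- The grading of a bimodule identified with the cohomology of a graded resolution. -/
def cohomologyGrMod {M : GrMod (envGrading 𝒜)} (P : GrProjRes M) {n : ℕ}
    {U : ModuleCat.{v} (Env k A)} (φ : P.cohomology n ≃+ U)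
    (hφ : ∀ (a b : A) (x : P.cohomology n),
      φ (op (b ⊗ₜ op a : Env k A) • x) = (a ⊗ₜ op b : Env k A) • φ x) :
    GrMod (envGrading 𝒜) where
  carrier := U
  deg γ := (P.cohomologyDeg n γ).comap φ.symm.toAddMonoidHom
  isInternal := isInternal_comap (P.cohomology_isInternal n) _ φ.symm.bijective
  smul_mem := env_smul_mem (deg := fun γ => (P.cohomologyDeg n γ).comap φ.symm.toAddMonoidHom)
    fun {i j l a b m} ha hb hm => by
    have hsymm : φ.symm ((a ⊗ₜ op b : Env k A) • m) = op (b ⊗ₜ op a : Env k A) • φ.symm m := by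
      rw [AddEquiv.symm_apply_eq, hφ, φ.apply_symm_apply]
    have hba : (b ⊗ₜ op a : Env k A) ∈ envGrading 𝒜 (i + j) :=
      Submodule.subset_span ⟨j, i, b, a, add_comm j i, hb, ha, rfl⟩
    change φ.symm _ ∈ P.cohomologyDeg n (i + j + l)
    rw [hsymm, add_comm]
    exact P.op_smul_mem_cohomologyDeg n hba hm

theorem IsTwistedCY.isGrTwistedCY {d : ℕ} (h : IsTwistedCY k A d) : IsGrTwistedCY 𝒜 d := by
  obtain ⟨hs, U, hU, hne, φ, hφ⟩ := h
  replace hs := (isHomologicallySmooth_iff 𝒜).1 hs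
  have E (n : ℕ) := (hs.nonempty_grExt_equiv n).some
  let ψ : grExt (grSelf 𝒜) d ≃+ U := (E d).toAddEquiv.trans φ
  have hψ (a b : A) (x : grExt (grSelf 𝒜) d) :
      ψ (op (b ⊗ₜ op a : Env k A) • x) = (a ⊗ₜ op b : Env k A) • ψ x :=
    (congrArg φ (map_smul (E d) _ x)).trans (hφ a b (E d x))
  refine ⟨hs, cohomologyGrMod _ ψ hψ, isGrInvertible_of_isInvertible _ hU, fun i hi => ?_, ψ, hψ,
    fun γ x => ?_⟩
  · have := hne i hi
    exact (E i).injective.subsingleton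
  · change _ ↔ ψ.symm (ψ x) ∈ grExtDeg (grSelf 𝒜) d γ
    rw [ψ.symm_apply_apply]

theorem IsGrTwistedCY.isTwistedCY {d : ℕ} (h : IsGrTwistedCY 𝒜 d) : IsTwistedCY k A d := by
  obtain ⟨hs, U, ⟨V, ⟨e, -⟩, ⟨e', -⟩⟩, hne, φ, hφ, -⟩ := h
  have E (n : ℕ) := (hs.nonempty_grExt_equiv n).some
  refine ⟨(isHomologicallySmooth_iff 𝒜).2 hs, U.forget, ⟨V.forget, ⟨e⟩, ⟨e'⟩⟩, fun i hi => ?_,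
    (E d).symm.toAddEquiv.trans φ, fun a b x => ?_⟩
  · have := hne i hi
    exact (E i).symm.injective.subsingleton
  · exact (congrArg φ (map_smul (E d).symm _ x)).trans (hφ a b ((E d).symm x))

end Main

end GradedCY

end

theorem theorem3p2 {k : Type u} [Field k] {A : Type v} [Ring A] [Algebra k A]
    {G : Type w} [AddCommGroup G] [DecidableEq G]
    (𝒜 : G → Submodule k A) [GradedAlgebra 𝒜] (d : ℕ) :
    GradedCY.IsTwistedCY k A d ↔ GradedCY.IsGrTwistedCY 𝒜 d :=
  ⟨fun h => h.isGrTwistedCY, fun h => h.isTwistedCY⟩
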